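/- Let $0\le p\le 1$ and let $(x_t)_{t\ge 0}$ be a sequence of instructions, i.e. an infinite nearest-neighbour walk in $\mathbb{Z}^2$ with $x_0=0$. The guided random walk with error probability $p$ and instructions $(x_t)$ is the Markov chain $(X_t)_{t\ge0}$ on $\mathbb{Z}^2$ with $X_0=0$ which, independently of the past, makes at each step the move $X_{t+1}-X_t=x_{t+1}-x_t$ with probability $1-p$, and with probability $p$ makes a move $X_{t+1}-X_t$ chosen uniformly at random from $\{(\pm1,0),(0,\pm1)\}$. For $x_{\mathrm{home}}\in\mathbb{Z}^2$ let $T=\inf\{t\ge 0: X_t=x_{\mathrm{home}}\}\in\{0,1,2,\dots\}\cup\{\infty\}$. Put $$R_4(p)=1+\tfrac14p^2+\tfrac12p(1-p)+\tfrac9{64}p^4+\tfrac9{16}p^3(1-p)+\tfrac38p^2(1-p)^2 .$$ **Theorem.** There is a number $p_0$ with $0.7805<p_0<0.7806$ that satisfies $$\frac{4}{\pi p_0\sqrt{3-2p_0}\,R_4(p_0)}=1$$ and such that for every $p$ with $p_0<p\le 1$, every sequence of instructions and every $x_{\mathrm{home}}\neq(0,0)$, the guided random walk satisfies $\mathbb{E}[T]=\infty$.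 -/

import Mathlib

open MeasureTheory
open scoped ENNReal

/-- The four unit steps `(±1, 0), (0, ±1)` of the grid `ℤ²`. -/
def gridSteps : Finset (ℤ × ℤ) := {(1, 0), (-1, 0), (0, 1), (0, -1)}

/-- A sequence of instructions: an infinite nearest-neighbour walk in `ℤ²` started at the origin. -/
structure IsInstructionSequence (x : ℕ → ℤ × ℤ) : Prop where
  zero : x 0 = 0
  step : ∀ t, x (t + 1) - x t ∈ gridSteps

/-- The probability that the agent moves by `v` when instructed to move by `d`: with probability
`1 - p` it moves by `d`, and with probability `p` by a uniformly random unit step. -/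
noncomputable def stepProb (p : ℝ) (d v : ℤ × ℤ) : ℝ :=
  (1 - p) * (if v = d then 1 else 0) + p * (if v ∈ gridSteps then 1 / 4 else 0)

/-- `X` is a guided random walk with error probability `p` and instructions `x` on the probability
space `(Ω, μ)`: a (time-inhomogeneous) Markov chain on `ℤ²` started at the origin that makes the
step `v` at time `t` with probability `stepProb p (x (t + 1) - x t) v`, whatever the past. The
Markov property is written in multiplied-out form, so that nothing is conditioned on a null
event. -/
structure IsGuidedRandomWalk {Ω : Type*} [MeasurableSpace Ω] (μ : Measure Ω) (p : ℝ)
    (x : ℕ → ℤ × ℤ) (X : ℕ → Ω → ℤ × ℤ) : Prop where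
  measurable : ∀ t, Measurable (X t)
  start : ∀ᵐ ω ∂μ, X 0 ω = 0
  markov : ∀ (t : ℕ) (y : ℕ → ℤ × ℤ),
    μ {ω | ∀ i ≤ t + 1, X i ω = y i} =
      μ {ω | ∀ i ≤ t, X i ω = y i} *
        ENNReal.ofReal (stepProb p (x (t + 1) - x t) (y (t + 1) - y t))

/-- The hitting time `T = inf {t : X_t = home}`, equal to `∞` if home is never visited. -/
noncomputable def hitTime {Ω : Type*} (X : ℕ → Ω → ℤ × ℤ) (home : ℤ × ℤ) (ω : Ω) : ℝ≥0∞ :=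
  ⨅ (t : ℕ) (_ : X t ω = home), (t : ℝ≥0∞)

/-- The polynomial `R₄(p)`: the least expected number of times `t ∈ {0, …, 4}` at which a guided
random walk is at its initial position, over all instructions. -/
noncomputable def returnPoly (p : ℝ) : ℝ :=
  1 + 1 / 4 * p ^ 2 + 1 / 2 * p * (1 - p) + 9 / 64 * p ^ 4 + 9 / 16 * p ^ 3 * (1 - p)
    + 3 / 8 * p ^ 2 * (1 - p) ^ 2

/-! Restart the walk at a point far from home, reached with positive probability
(`IsGuidedRandomWalk.exists_far`). Write a_n = P(T > n) and f_τ = P(T = τ) for the restarted walk,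
and suppose E[T] = Σ a_n < ∞. Kill the walk at home only up to time ⌊t/2⌋, let it run freely
afterwards, and compute in two ways the probability q_t that it sits at home at time t.

Decomposing at the first entrance after ⌊t/2⌋ gives q_t = Σ f_τ r(τ, t) over t/2 < τ ≤ t, with r(τ,
t) the probability that the free walk is at time t where it was at time τ. Since r(τ, τ) + r(τ, τ+2)
+ r(τ, τ+4) ≥ R₄(p) for all instructions (`returnPoly_le`), Σ t q_t ≥ R₄(p) Σ τ f_τ = R₄(p) E[T].
Conversely, if k-step displacements have probability at most K/k, then t q_t ≤ 2K a_⌊t/2⌋; by parity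
only one of q_{2j}, q_{2j+1} is nonzero, so Σ t q_t ≤ 2K E[T]. This is impossible when 2K < R₄(p)
(`not_summable_mass_killedLaw`).

The local bound comes from Fourier inversion. Up to swapping coordinates, all four instructions give
a characteristic function of the same modulus, so AM-GM bounds every k-step law by one integral
(`coeff_pathLaw_le_fourierBound`). That modulus peaks at (0, 0) and (π, π), and Laplace's method
yields any K above 2/(πp√(3-2p)) for large k (`tendsto_mul_fourierBound`). The condition becomes
πp√(3-2p) R₄(p) > 4, whose left side increases in p. -/

/-! ### Step laws and path laws in the group algebra -/

/-- The real group algebra of `ℤ²`: finitely supported signed weights on the grid, multiplied by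
convolution. -/
abbrev GridAlgebra : Type := AddMonoidAlgebra ℝ (ℤ × ℤ)

/-- The law of one step of the guided walk with instruction `d`. -/
noncomputable def stepLaw (p : ℝ) (d : ℤ × ℤ) : GridAlgebra :=
  ∑ v ∈ gridSteps, AddMonoidAlgebra.single v (stepProb p d v)

/-- The law of the displacement of the guided walk between the times `m` and `t`. -/
noncomputable def pathLaw (p : ℝ) (d : ℕ → ℤ × ℤ) (m t : ℕ) : GridAlgebra :=
  ∏ i ∈ Finset.Ico m t, stepLaw p (d i)

/-- The total mass of an element of the group algebra. -/
noncomputable def mass : GridAlgebra →ₐ[ℝ] ℝ := AddMonoidAlgebra.lift ℝ ℝ (ℤ × ℤ) 1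

lemma sum_gridSteps {M : Type*} [AddCommMonoid M] (f : ℤ × ℤ → M) :
    ∑ v ∈ gridSteps, f v = f (1, 0) + f (-1, 0) + f (0, 1) + f (0, -1) := by
  simp [gridSteps, add_assoc]

lemma mem_gridSteps {v : ℤ × ℤ} :
    v ∈ gridSteps ↔ v = (1, 0) ∨ v = (-1, 0) ∨ v = (0, 1) ∨ v = (0, -1) := by
  simp [gridSteps]

lemma stepProb_nonneg {p : ℝ} (h0 : 0 ≤ p) (h1 : p ≤ 1) (d v : ℤ × ℤ) : 0 ≤ stepProb p d v := by
  unfold stepProb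
  have : 0 ≤ 1 - p := by linarith
  split_ifs <;> simp <;> linarith

lemma sum_stepProb {p : ℝ} {d : ℤ × ℤ} (hd : d ∈ gridSteps) :
    ∑ v ∈ gridSteps, stepProb p d v = 1 := by
  rcases mem_gridSteps.1 hd with rfl | rfl | rfl | rfl <;>
    · simp [sum_gridSteps, stepProb, mem_gridSteps]
      ring

lemma mass_single (z : ℤ × ℤ) (r : ℝ) : mass (AddMonoidAlgebra.single z r) = r := by
  simp [mass]

lemma mass_eq_sum (u : GridAlgebra) : mass u = u.coeff.sum fun _ r => r := by
  simp [mass, AddMonoidAlgebra.lift_apply]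

lemma mass_stepLaw {p : ℝ} {d : ℤ × ℤ} (hd : d ∈ gridSteps) : mass (stepLaw p d) = 1 := by
  simp only [stepLaw, map_sum, mass_single, sum_stepProb hd]

lemma coeff_mul_stepLaw (u : GridAlgebra) (p : ℝ) (d z : ℤ × ℤ) :
    (u * stepLaw p d).coeff z = ∑ v ∈ gridSteps, u.coeff (z - v) * stepProb p d v := by
  simp [stepLaw, Finset.mul_sum, Finsupp.finsetSum_apply, sub_eq_add_neg]

lemma coeff_mul_nonneg {u w : GridAlgebra} (hu : ∀ z, 0 ≤ u.coeff z) (hw : ∀ z, 0 ≤ w.coeff z)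
    (z : ℤ × ℤ) : 0 ≤ (u * w).coeff z := by
  rw [AddMonoidAlgebra.coeff_mul]
  refine Finset.sum_nonneg fun i _ => Finset.sum_nonneg fun j _ => ?_
  beta_reduce
  split_ifs
  · exact mul_nonneg (hu i) (hw j)
  · exact le_rfl

lemma coeff_single_nonneg {r : ℝ} (hr : 0 ≤ r) (y z : ℤ × ℤ) :
    0 ≤ (AddMonoidAlgebra.single y r : GridAlgebra).coeff z := by
  rw [AddMonoidAlgebra.coeff_single, Finsupp.single_apply]
  split_ifs <;> simp [hr]

lemma coeff_stepLaw_nonneg {p : ℝ} (h0 : 0 ≤ p) (h1 : p ≤ 1) (d z : ℤ × ℤ) :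
    0 ≤ (stepLaw p d).coeff z := by
  rw [stepLaw, AddMonoidAlgebra.coeff_sum, Finsupp.finsetSum_apply]
  exact Finset.sum_nonneg fun v _ => coeff_single_nonneg (stepProb_nonneg h0 h1 d v) v z

lemma coeff_pathLaw_nonneg {p : ℝ} (h0 : 0 ≤ p) (h1 : p ≤ 1) (d : ℕ → ℤ × ℤ) (m t : ℕ) :
    ∀ z, 0 ≤ (pathLaw p d m t).coeff z := by
  unfold pathLaw
  refine Finset.prod_induction _ (fun u : GridAlgebra => ∀ z, 0 ≤ u.coeff z)
    (fun u w hu hw => coeff_mul_nonneg hu hw) ?_ fun i _ => coeff_stepLaw_nonneg h0 h1 (d i)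
  exact fun z => coeff_single_nonneg zero_le_one 0 z

lemma pathLaw_self (p : ℝ) (d : ℕ → ℤ × ℤ) (m : ℕ) : pathLaw p d m m = 1 := by
  simp [pathLaw]

lemma pathLaw_succ (p : ℝ) (d : ℕ → ℤ × ℤ) {m t : ℕ} (h : m ≤ t) :
    pathLaw p d m (t + 1) = pathLaw p d m t * stepLaw p (d t) := by
  simp [pathLaw, Finset.prod_Ico_succ_top h]

lemma mass_nonneg {u : GridAlgebra} (hu : ∀ z, 0 ≤ u.coeff z) : 0 ≤ mass u := by
  rw [mass_eq_sum]
  exact Finset.sum_nonneg fun i _ => hu i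

/-- A convolution averages translates of `w` with weights `u`, so a uniform bound on `w` survives up
to the total weight. -/
lemma coeff_mul_le_mass_mul {u w : GridAlgebra} {B : ℝ} (hu : ∀ z, 0 ≤ u.coeff z)
    (hw : ∀ z, w.coeff z ≤ B) (z : ℤ × ℤ) : (u * w).coeff z ≤ mass u * B := by
  have h : u * w = u.coeff.sum fun y r => AddMonoidAlgebra.single y r * w := by
    conv_lhs => rw [← AddMonoidAlgebra.sum_coeff_single u]
    simp only [Finsupp.sum, Finset.sum_mul]
  rw [h, mass_eq_sum, Finsupp.sum, Finsupp.sum, AddMonoidAlgebra.coeff_sum,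
    Finsupp.finsetSum_apply, Finset.sum_mul]
  refine Finset.sum_le_sum fun y _ => ?_
  rw [AddMonoidAlgebra.coeff_single_mul_apply]
  exact mul_le_mul_of_nonneg_left (hw _) (hu y)

lemma exists_of_coeff_mul_stepLaw_ne_zero {u : GridAlgebra} {p : ℝ} {d z : ℤ × ℤ}
    (h : (u * stepLaw p d).coeff z ≠ 0) : ∃ v ∈ gridSteps, u.coeff (z - v) ≠ 0 := by
  rw [coeff_mul_stepLaw] at h
  obtain ⟨v, hv, hne⟩ := Finset.exists_ne_zero_of_sum_ne_zero h
  exact ⟨v, hv, left_ne_zero_of_mul hne⟩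

/-! ### The walk killed at home and its first entrance -/

section Killed

variable (p : ℝ) (d : ℕ → ℤ × ℤ) (home y : ℤ × ℤ)

/-- The law at time `n` of the guided walk started at `y` and killed when it enters `home`. -/
noncomputable def killedLaw : ℕ → GridAlgebra
  | 0 => AddMonoidAlgebra.single y 1
  | n + 1 => (killedLaw n * stepLaw p (d n)).erase home

/-- The probability that the walk started at `y` enters `home` at time `n` for the first time. -/
noncomputable def firstHit : ℕ → ℝ
  | 0 => 0
  | n + 1 => (killedLaw p d home y n * stepLaw p (d n)).coeff home

variable {p d home y}

lemma killedLaw_add_single (n : ℕ) :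
    killedLaw p d home y (n + 1) + AddMonoidAlgebra.single home (firstHit p d home y (n + 1)) =
      killedLaw p d home y n * stepLaw p (d n) :=
  AddMonoidAlgebra.erase_add_single _ _

lemma killedLaw_coeff_nonneg (h0 : 0 ≤ p) (h1 : p ≤ 1) (n : ℕ) :
    ∀ z, 0 ≤ (killedLaw p d home y n).coeff z := by
  induction n with
  | zero => exact fun z => coeff_single_nonneg zero_le_one y z
  | succ n ih =>
    intro z
    rw [killedLaw, AddMonoidAlgebra.coeff_erase, Finsupp.erase_apply]
    split_ifs
    · exact le_rfl
    · exact coeff_mul_nonneg ih (coeff_stepLaw_nonneg h0 h1 _) z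

lemma firstHit_nonneg (h0 : 0 ≤ p) (h1 : p ≤ 1) (n : ℕ) : 0 ≤ firstHit p d home y n := by
  cases n with
  | zero => exact le_rfl
  | succ n =>
    exact coeff_mul_nonneg (killedLaw_coeff_nonneg h0 h1 n) (coeff_stepLaw_nonneg h0 h1 _) home

/-- Steps preserve mass, and erasing `home` removes exactly the first-entrance probability. -/
lemma mass_killedLaw_succ (hd : ∀ i, d i ∈ gridSteps) (n : ℕ) :
    mass (killedLaw p d home y (n + 1)) =
      mass (killedLaw p d home y n) - firstHit p d home y (n + 1) := by
  have h := congrArg mass (killedLaw_add_single (p := p) (d := d) (home := home) (y := y) n)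
  rw [map_add, map_mul, mass_single, mass_stepLaw (hd n)] at h
  linarith

lemma killedLaw_coeff_home (hy : y ≠ home) (n : ℕ) : (killedLaw p d home y n).coeff home = 0 := by
  cases n with
  | zero => simp [killedLaw, hy.symm]
  | succ n => simp [killedLaw]

/-- First-entrance decomposition of the walk that is killed only up to time `m`. -/
lemma killedLaw_mul_pathLaw (m k : ℕ) :
    killedLaw p d home y m * pathLaw p d m (m + k) = killedLaw p d home y (m + k) +
      ∑ τ ∈ Finset.Ioc m (m + k), AddMonoidAlgebra.single home (firstHit p d home y τ) *
        pathLaw p d τ (m + k) := by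
  induction k with
  | zero => simp [pathLaw_self]
  | succ k ih =>
    rw [← add_assoc, pathLaw_succ p d (by omega), ← mul_assoc, ih, add_mul,
      ← killedLaw_add_single, Finset.sum_Ioc_succ_top (by omega), pathLaw_self, mul_one,
      Finset.sum_mul]
    have : ∀ τ ∈ Finset.Ioc m (m + k),
        AddMonoidAlgebra.single home (firstHit p d home y τ) * pathLaw p d τ (m + k) *
          stepLaw p (d (m + k)) =
        AddMonoidAlgebra.single home (firstHit p d home y τ) * pathLaw p d τ (m + k + 1) := by
      intro τ hτ
      rw [pathLaw_succ p d (Finset.mem_Ioc.1 hτ).2, mul_assoc]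
    rw [Finset.sum_congr rfl this]
    abel

/-- The killed part has no weight at `home`, so only the entrances after time `m` remain. -/
lemma coeff_killedLaw_mul_pathLaw (hy : y ≠ home) {m t : ℕ} (h : m ≤ t) :
    (killedLaw p d home y m * pathLaw p d m t).coeff home =
      ∑ τ ∈ Finset.Ioc m t, firstHit p d home y τ * (pathLaw p d τ t).coeff 0 := by
  obtain ⟨k, rfl⟩ := Nat.exists_eq_add_of_le h
  rw [killedLaw_mul_pathLaw, AddMonoidAlgebra.coeff_add, Finsupp.add_apply,
    killedLaw_coeff_home hy, zero_add, AddMonoidAlgebra.coeff_sum, Finsupp.finsetSum_apply]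
  simp

/-- Parity of the position is determined by the time. -/
lemma parity_of_killedLaw_coeff_ne_zero (n : ℕ) : ∀ z, (killedLaw p d home y n).coeff z ≠ 0 →
    (z.1 + z.2 - (y.1 + y.2) - n) % 2 = 0 := by
  induction n with
  | zero =>
    intro z hz
    rw [killedLaw, AddMonoidAlgebra.coeff_single, Finsupp.single_apply] at hz
    have : y = z := by by_contra h; simp [h] at hz
    subst this; simp
  | succ n ih =>
    intro z hz
    have hz' : (killedLaw p d home y n * stepLaw p (d n)).coeff z ≠ 0 := by
      intro h
      apply hz
      rw [killedLaw, AddMonoidAlgebra.coeff_erase, Finsupp.erase_apply, h, ite_self]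
    obtain ⟨v, hv, hne⟩ := exists_of_coeff_mul_stepLaw_ne_zero hz'
    have := ih _ hne
    rcases mem_gridSteps.1 hv with rfl | rfl | rfl | rfl <;> simp at this ⊢ <;> omega

lemma parity_of_coeff_killedLaw_mul_pathLaw_ne_zero (m k : ℕ) : ∀ z,
    (killedLaw p d home y m * pathLaw p d m (m + k)).coeff z ≠ 0 →
    (z.1 + z.2 - (y.1 + y.2) - (m + k : ℕ)) % 2 = 0 := by
  induction k with
  | zero => simpa [pathLaw_self] using parity_of_killedLaw_coeff_ne_zero m
  | succ k ih =>
    intro z hz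
    rw [← add_assoc, pathLaw_succ p d (by omega), ← mul_assoc] at hz
    obtain ⟨v, hv, hne⟩ := exists_of_coeff_mul_stepLaw_ne_zero hz
    have := ih _ hne
    rcases mem_gridSteps.1 hv with rfl | rfl | rfl | rfl <;> simp at this ⊢ <;> omega

/-- The walk moves by at most one unit per step. -/
lemma dist_le_of_killedLaw_coeff_ne_zero (n : ℕ) : ∀ z, (killedLaw p d home y n).coeff z ≠ 0 →
    |z.1 - y.1| + |z.2 - y.2| ≤ n := by
  induction n with
  | zero =>
    intro z hz
    rw [killedLaw, AddMonoidAlgebra.coeff_single, Finsupp.single_apply] at hz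
    have : y = z := by by_contra h; simp [h] at hz
    subst this; simp
  | succ n ih =>
    intro z hz
    have hz' : (killedLaw p d home y n * stepLaw p (d n)).coeff z ≠ 0 := by
      intro h
      apply hz
      rw [killedLaw, AddMonoidAlgebra.coeff_erase, Finsupp.erase_apply, h, ite_self]
    obtain ⟨v, hv, hne⟩ := exists_of_coeff_mul_stepLaw_ne_zero hz'
    have := ih _ hne
    have h1 := abs_sub_abs_le_abs_sub (z.1 - y.1) v.1
    have h2 := abs_sub_abs_le_abs_sub (z.2 - y.2) v.2
    simp only [Prod.fst_sub, Prod.snd_sub, sub_right_comm] at this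
    have hv' : |v.1| + |v.2| = 1 := by
      rcases mem_gridSteps.1 hv with rfl | rfl | rfl | rfl <;> simp
    push_cast
    linarith

lemma firstHit_eq_zero_of_lt {n : ℕ} (h : (n : ℤ) < |home.1 - y.1| + |home.2 - y.2|) :
    firstHit p d home y n = 0 := by
  cases n with
  | zero => rfl
  | succ n =>
    by_contra hne
    obtain ⟨v, hv, hne⟩ := exists_of_coeff_mul_stepLaw_ne_zero hne
    have := dist_le_of_killedLaw_coeff_ne_zero _ _ hne
    have h1 := abs_sub_abs_le_abs_sub (home.1 - y.1) v.1
    have h2 := abs_sub_abs_le_abs_sub (home.2 - y.2) v.2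
    simp only [Prod.fst_sub, Prod.snd_sub, sub_right_comm] at this
    have hv' : |v.1| + |v.2| = 1 := by
      rcases mem_gridSteps.1 hv with rfl | rfl | rfl | rfl <;> simp
    push_cast at h
    linarith

end Killed

/-! ### Lower bounds for returns within four steps -/

/-- The law of one step of the simple random walk. -/
noncomputable def uniformStep : GridAlgebra :=
  ∑ v ∈ gridSteps, AddMonoidAlgebra.single v (1 / 4 : ℝ)

/-- Products of step laws can then be expanded according to which steps are errors. -/
lemma stepLaw_eq {p : ℝ} {d : ℤ × ℤ} (hd : d ∈ gridSteps) :
    stepLaw p d = (1 - p) • AddMonoidAlgebra.single d 1 + p • uniformStep := by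
  simp only [stepLaw, uniformStep, stepProb, AddMonoidAlgebra.single_add, Finset.sum_add_distrib,
    Finset.smul_sum, AddMonoidAlgebra.smul_single, smul_eq_mul]
  congr 1
  · rw [Finset.sum_eq_single_of_mem d hd]
    · simp
    · intro b _ hb
      simp [hb]

lemma coeff_mul_uniformStep (u : GridAlgebra) (z : ℤ × ℤ) :
    (u * uniformStep).coeff z = 1 / 4 * ∑ v ∈ gridSteps, u.coeff (z - v) := by
  simp [uniformStep, Finset.mul_sum, Finsupp.finsetSum_apply, sub_eq_add_neg, mul_comm]

lemma coeff_uniformStep (z : ℤ × ℤ) :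
    uniformStep.coeff z = if z ∈ gridSteps then 1 / 4 else 0 := by
  simp [uniformStep, Finsupp.finsetSum_apply, Finsupp.single_apply]

lemma coeff_uniformStep_nonneg (z : ℤ × ℤ) : 0 ≤ uniformStep.coeff z := by
  rw [coeff_uniformStep]
  split_ifs <;> norm_num

lemma coeff_uniformStep_sq (z : ℤ × ℤ) : (uniformStep * uniformStep).coeff z =
    1 / 4 * ∑ v ∈ gridSteps, if z - v ∈ gridSteps then 1 / 4 else 0 := by
  simp only [coeff_mul_uniformStep, coeff_uniformStep]

lemma coeff_uniformStep_sq_zero : (uniformStep * uniformStep).coeff 0 = 1 / 4 := by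
  rw [coeff_uniformStep_sq, sum_gridSteps]
  norm_num [mem_gridSteps]

/-- The single path with steps `-d`, `-e` already has probability 1/16. -/
lemma le_coeff_uniformStep_sq {d e : ℤ × ℤ} (hd : d ∈ gridSteps) (he : e ∈ gridSteps) :
    1 / 16 ≤ (uniformStep * uniformStep).coeff (-(d + e)) := by
  rw [coeff_uniformStep_sq, Finset.mul_sum]
  have hd' : -d ∈ gridSteps := by
    rcases mem_gridSteps.1 hd with rfl | rfl | rfl | rfl <;> simp [mem_gridSteps]
  have he' : -(d + e) - -d ∈ gridSteps := by
    rcases mem_gridSteps.1 he with rfl | rfl | rfl | rfl <;> simp [mem_gridSteps]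
  refine le_trans ?_ (Finset.single_le_sum (f := fun v =>
    (1 / 4 : ℝ) * if -(d + e) - v ∈ gridSteps then 1 / 4 else 0) ?_ hd')
  · simp only [he', if_true]; norm_num
  · intro v _
    split_ifs <;> norm_num

lemma coeff_uniformStep_cube {d : ℤ × ℤ} (hd : d ∈ gridSteps) :
    (uniformStep * uniformStep * uniformStep).coeff (-d) = 9 / 64 := by
  rw [coeff_mul_uniformStep]
  simp only [coeff_uniformStep_sq, sum_gridSteps]
  rcases mem_gridSteps.1 hd with rfl | rfl | rfl | rfl <;> norm_num [mem_gridSteps]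

lemma coeff_uniformStep_fourth :
    (uniformStep * uniformStep * uniformStep * uniformStep).coeff 0 = 9 / 64 := by
  rw [coeff_mul_uniformStep]
  simp only [zero_sub]
  rw [Finset.sum_congr rfl fun v hv => coeff_uniformStep_cube hv, sum_gridSteps]
  norm_num

lemma coeff_single_mul_zero (d : ℤ × ℤ) (u : GridAlgebra) :
    (AddMonoidAlgebra.single d 1 * u).coeff 0 = u.coeff (-d) := by
  simp

lemma le_coeff_stepLaw_mul {p : ℝ} {d e : ℤ × ℤ}
    (hd : d ∈ gridSteps) (he : e ∈ gridSteps) :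
    1 / 4 * p ^ 2 + 1 / 2 * p * (1 - p) ≤ (stepLaw p d * stepLaw p e).coeff 0 := by
  set D : GridAlgebra := AddMonoidAlgebra.single d 1 with hD
  set E : GridAlgebra := AddMonoidAlgebra.single e 1 with hE
  have hne : ∀ v ∈ gridSteps, uniformStep.coeff (-v) = 1 / 4 := by
    intro v hv
    rw [coeff_uniformStep, if_pos]
    rcases mem_gridSteps.1 hv with rfl | rfl | rfl | rfl <;> simp [mem_gridSteps]
  have key : stepLaw p d * stepLaw p e = p ^ 2 • (uniformStep * uniformStep)
      + (p * (1 - p)) • (D * uniformStep) + (p * (1 - p)) • (E * uniformStep)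
      + (1 - p) ^ 2 • (D * E) := by
    rw [stepLaw_eq hd, stepLaw_eq he, ← hD, ← hE]
    simp only [Algebra.smul_def, map_mul, map_pow, map_sub]
    ring
  have hDE : 0 ≤ (D * E).coeff 0 :=
    coeff_mul_nonneg (coeff_single_nonneg zero_le_one d) (coeff_single_nonneg zero_le_one e) 0
  rw [key]
  simp only [AddMonoidAlgebra.coeff_add, AddMonoidAlgebra.coeff_smul, Finsupp.add_apply,
    Finsupp.smul_apply, smul_eq_mul, coeff_uniformStep_sq_zero]
  rw [hD, hE, coeff_single_mul_zero d uniformStep, coeff_single_mul_zero e uniformStep, hne d hd,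
    hne e he]
  nlinarith [mul_nonneg (sq_nonneg (1 - p)) hDE]

/-- Expand by the number of errors. Four errors return with probability 9/64; with three, the errors
must undo one instruction (4 · 9/64); with two, they must undo a pair (6 pairs, at least 1/16 each).
Terms with fewer errors are nonnegative and dropped. -/
lemma le_coeff_stepLaw_mul_mul_mul {p : ℝ} (h0 : 0 ≤ p) (h1 : p ≤ 1) {a b c e : ℤ × ℤ}
    (ha : a ∈ gridSteps) (hb : b ∈ gridSteps) (hc : c ∈ gridSteps) (he : e ∈ gridSteps) :
    9 / 64 * p ^ 4 + 9 / 16 * p ^ 3 * (1 - p) + 3 / 8 * p ^ 2 * (1 - p) ^ 2 ≤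
      (stepLaw p a * stepLaw p b * stepLaw p c * stepLaw p e).coeff 0 := by
  set U := uniformStep with hU
  let s : ℤ × ℤ → GridAlgebra := fun v => AddMonoidAlgebra.single v 1
  have hs : ∀ v z, 0 ≤ (s v).coeff z := fun v z => coeff_single_nonneg zero_le_one v z
  have hss : ∀ v w, s v * s w = s (v + w) := by intro v w; simp [s]
  set T : GridAlgebra := s a * s b * s c * U + s a * s b * s e * U + s a * s c * s e * U
    + s b * s c * s e * U with hT
  set F : GridAlgebra := s a * s b * s c * s e with hF
  have key : stepLaw p a * stepLaw p b * stepLaw p c * stepLaw p e =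
      p ^ 4 • (U * U * U * U)
      + (p ^ 3 * (1 - p)) • (s a * (U * U * U) + s b * (U * U * U) + s c * (U * U * U)
          + s e * (U * U * U))
      + (p ^ 2 * (1 - p) ^ 2) • (s (a + b) * (U * U) + s (a + c) * (U * U) + s (a + e) * (U * U)
          + s (b + c) * (U * U) + s (b + e) * (U * U) + s (c + e) * (U * U))
      + (p * (1 - p) ^ 3) • T + (1 - p) ^ 4 • F := by
    rw [stepLaw_eq ha, stepLaw_eq hb, stepLaw_eq hc, stepLaw_eq he]
    simp only [← hss, hT, hF, ← hU, s]
    simp only [Algebra.smul_def, map_mul, map_pow, map_sub]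
    ring
  have hnn : ∀ u v w x : GridAlgebra, (∀ z, 0 ≤ u.coeff z) → (∀ z, 0 ≤ v.coeff z) →
      (∀ z, 0 ≤ w.coeff z) → (∀ z, 0 ≤ x.coeff z) → 0 ≤ (u * v * w * x).coeff 0 :=
    fun u v w x hu hv hw hx => coeff_mul_nonneg (coeff_mul_nonneg (coeff_mul_nonneg hu hv) hw) hx 0
  have hT0 : 0 ≤ T.coeff 0 := by
    rw [hT]
    simp only [AddMonoidAlgebra.coeff_add, Finsupp.add_apply]
    have := hnn _ _ _ _ (hs a) (hs b) (hs c) coeff_uniformStep_nonneg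
    have := hnn _ _ _ _ (hs a) (hs b) (hs e) coeff_uniformStep_nonneg
    have := hnn _ _ _ _ (hs a) (hs c) (hs e) coeff_uniformStep_nonneg
    have := hnn _ _ _ _ (hs b) (hs c) (hs e) coeff_uniformStep_nonneg
    linarith
  have hF0 : 0 ≤ F.coeff 0 := hnn _ _ _ _ (hs a) (hs b) (hs c) (hs e)
  have hq : 0 ≤ 1 - p := by linarith
  have hTt : 0 ≤ p * (1 - p) ^ 3 * T.coeff 0 := by positivity
  have hFt : 0 ≤ (1 - p) ^ 4 * F.coeff 0 := by positivity
  have h2 : 0 ≤ p ^ 2 * (1 - p) ^ 2 := by positivity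
  rw [key]
  simp only [AddMonoidAlgebra.coeff_add, AddMonoidAlgebra.coeff_smul, Finsupp.add_apply,
    Finsupp.smul_apply, smul_eq_mul, s, coeff_single_mul_zero]
  rw [coeff_uniformStep_fourth, coeff_uniformStep_cube ha, coeff_uniformStep_cube hb,
    coeff_uniformStep_cube hc, coeff_uniformStep_cube he]
  have hpair := mul_le_mul_of_nonneg_left (add_le_add (add_le_add (add_le_add (add_le_add
    (add_le_add (le_coeff_uniformStep_sq ha hb) (le_coeff_uniformStep_sq ha hc))
    (le_coeff_uniformStep_sq ha he)) (le_coeff_uniformStep_sq hb hc))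
    (le_coeff_uniformStep_sq hb he)) (le_coeff_uniformStep_sq hc he)) h2
  linarith

lemma returnPoly_le {p : ℝ} (h0 : 0 ≤ p) (h1 : p ≤ 1) {d : ℕ → ℤ × ℤ}
    (hd : ∀ i, d i ∈ gridSteps) (τ : ℕ) :
    returnPoly p ≤ (pathLaw p d τ τ).coeff 0 + (pathLaw p d τ (τ + 2)).coeff 0
      + (pathLaw p d τ (τ + 4)).coeff 0 := by
  have e0 : (pathLaw p d τ τ).coeff 0 = 1 := by
    rw [pathLaw_self]; exact AddMonoidAlgebra.coeff_one_zero
  have e2 : pathLaw p d τ (τ + 2) = stepLaw p (d τ) * stepLaw p (d (τ + 1)) := by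
    rw [pathLaw_succ p d (by omega), pathLaw_succ p d le_rfl, pathLaw_self, one_mul]
  have e4 : pathLaw p d τ (τ + 4) = stepLaw p (d τ) * stepLaw p (d (τ + 1))
      * stepLaw p (d (τ + 2)) * stepLaw p (d (τ + 3)) := by
    rw [pathLaw_succ p d (by omega), pathLaw_succ p d (by omega), e2]
  rw [e0, e2, e4, returnPoly]
  have := le_coeff_stepLaw_mul (p := p) (hd τ) (hd (τ + 1))
  have := le_coeff_stepLaw_mul_mul_mul h0 h1 (hd τ) (hd (τ + 1)) (hd (τ + 2)) (hd (τ + 3))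
  linarith

/-! ### The double count of time-weighted visits -/

/-- A summable antitone sequence of nonnegative reals is `o(1/n)`. -/
lemma tendsto_mul_of_antitone_of_summable {a : ℕ → ℝ} (ha : Antitone a) (h0 : ∀ n, 0 ≤ a n)
    (hs : Summable a) : Filter.Tendsto (fun n : ℕ => (n : ℝ) * a n) Filter.atTop (nhds 0) := by
  have htail : Filter.Tendsto (fun n : ℕ => 2 * ∑' k, a (k + n / 2)) Filter.atTop (nhds 0) := by
    have h := (tendsto_sum_nat_add a).comp (Nat.tendsto_div_const_atTop two_ne_zero)
    simpa using h.const_mul 2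
  refine squeeze_zero (fun n => mul_nonneg n.cast_nonneg (h0 n)) (fun n => ?_) htail
  have hs' : Summable fun k => a (k + n / 2) := (summable_nat_add_iff (n / 2)).2 hs
  have h1 : ∑ k ∈ Finset.range (n - n / 2), a (k + n / 2) ≤ ∑' k, a (k + n / 2) :=
    hs'.sum_le_tsum _ fun i _ => h0 _
  have h2 : ((n - n / 2 : ℕ) : ℝ) * a n ≤ ∑ k ∈ Finset.range (n - n / 2), a (k + n / 2) := by
    have := Finset.card_nsmul_le_sum (Finset.range (n - n / 2)) (fun k => a (k + n / 2)) (a n)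
      fun k hk => ha (by have := Finset.mem_range.1 hk; omega)
    simpa using this
  have h3 : (n : ℝ) ≤ 2 * ((n - n / 2 : ℕ) : ℝ) := by
    have : n ≤ 2 * (n - n / 2) := by omega
    exact_mod_cast this
  nlinarith [h0 n]

lemma sum_range_two_mul {M : Type*} [AddCommMonoid M] (g : ℕ → M) (n : ℕ) :
    ∑ t ∈ Finset.range (2 * n), g t = ∑ j ∈ Finset.range n, (g (2 * j) + g (2 * j + 1)) := by
  induction n with
  | zero => simp
  | succ n ih =>
    rw [Finset.sum_range_succ, ← ih, show 2 * (n + 1) = 2 * n + 1 + 1 by ring,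
      Finset.sum_range_succ, Finset.sum_range_succ, add_assoc]

section Killed

variable {p : ℝ} {d : ℕ → ℤ × ℤ} {home y : ℤ × ℤ}

/-- Abel summation, since the first-entrance probabilities are the decrements of the surviving mass.
-/
lemma sum_mul_firstHit (hd : ∀ i, d i ∈ gridSteps) (N : ℕ) :
    ∑ τ ∈ Finset.range (N + 1), (τ : ℝ) * firstHit p d home y τ =
      ∑ j ∈ Finset.range N, mass (killedLaw p d home y j) - N * mass (killedLaw p d home y N) := by
  induction N with
  | zero => simp
  | succ N ih =>
    rw [Finset.sum_range_succ, ih, Finset.sum_range_succ, mass_killedLaw_succ hd]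
    push_cast
    ring

/-- The expected number of visits weighted by time dominates the expected entrance time. -/
lemma returnPoly_mul_sum_le (h0 : 0 ≤ p) (h1 : p ≤ 1) (hd : ∀ i, d i ∈ gridSteps)
    (hL : 5 ≤ |home.1 - y.1| + |home.2 - y.2|) (N : ℕ) :
    returnPoly p * ∑ τ ∈ Finset.range (N + 1), (τ : ℝ) * firstHit p d home y τ ≤
      ∑ t ∈ Finset.range (N + 5), (t : ℝ) *
        ∑ τ ∈ Finset.Ioc (t / 2) t, firstHit p d home y τ * (pathLaw p d τ t).coeff 0 := by
  have hf := firstHit_nonneg (d := d) (home := home) (y := y) h0 h1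
  have hr := fun τ t => coeff_pathLaw_nonneg h0 h1 d τ t 0
  have hswap : ∑ t ∈ Finset.range (N + 5), (t : ℝ) *
        ∑ τ ∈ Finset.Ioc (t / 2) t, firstHit p d home y τ * (pathLaw p d τ t).coeff 0 =
      ∑ τ ∈ Finset.range (N + 5), ∑ t ∈ (Finset.range (N + 5)).filter (fun t => t / 2 < τ ∧ τ ≤ t),
        (t : ℝ) * (firstHit p d home y τ * (pathLaw p d τ t).coeff 0) := by
    simp only [Finset.mul_sum]
    refine Finset.sum_comm' fun t τ => ?_
    simp only [Finset.mem_range, Finset.mem_Ioc, Finset.mem_filter]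
    omega
  rw [hswap, Finset.mul_sum]
  refine le_trans ?_ (Finset.sum_le_sum_of_subset_of_nonneg
    (Finset.range_subset_range.2 (show N + 1 ≤ N + 5 by omega)) fun τ _ _ =>
      Finset.sum_nonneg fun t _ => mul_nonneg t.cast_nonneg (mul_nonneg (hf τ) (hr τ t)))
  refine Finset.sum_le_sum fun τ hτ => ?_
  rw [Finset.mem_range] at hτ
  -- τ + 4 is in range only if (τ + 4) / 2 < τ, that is τ ≥ 5; earlier entrances are excluded by the
  -- distance.
  rcases lt_or_ge τ 5 with h5 | h5
  · rw [firstHit_eq_zero_of_lt (lt_of_lt_of_le (by exact_mod_cast h5) hL)]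
    simp
  have hsub : ({τ, τ + 2, τ + 4} : Finset ℕ) ⊆
      (Finset.range (N + 5)).filter (fun t => t / 2 < τ ∧ τ ≤ t) := by
    intro t ht
    simp only [Finset.mem_insert, Finset.mem_singleton] at ht
    simp only [Finset.mem_range, Finset.mem_filter]
    omega
  refine le_trans ?_ (Finset.sum_le_sum_of_subset_of_nonneg hsub fun t _ _ =>
    mul_nonneg t.cast_nonneg (mul_nonneg (hf τ) (hr τ t)))
  rw [Finset.sum_insert (by simp), Finset.sum_insert (by simp), Finset.sum_singleton]
  -- The weights τ + 2 and τ + 4 are lowered to τ.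
  have hR := returnPoly_le h0 h1 hd τ
  have e2 := mul_nonneg (hf τ) (hr τ (τ + 2))
  have e4 := mul_nonneg (hf τ) (hr τ (τ + 4))
  have e := mul_le_mul_of_nonneg_left hR (mul_nonneg (Nat.cast_nonneg (α := ℝ) τ) (hf τ))
  push_cast
  nlinarith

/-- If displacements over `n` steps have probabilities at most `K / n` with `2 K < R₄(p)`, then
the walk started far away from home has infinite expected entrance time. -/
theorem not_summable_mass_killedLaw (h0 : 0 ≤ p) (h1 : p ≤ 1) (hd : ∀ i, d i ∈ gridSteps)
    {K : ℝ} {n₀ : ℕ}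
    (hB : ∀ m k : ℕ, n₀ ≤ k → ∀ z, k * (pathLaw p d m (m + k)).coeff z ≤ K)
    (hK : 2 * K < returnPoly p) (hL : 2 * n₀ + 5 ≤ |home.1 - y.1| + |home.2 - y.2|) :
    ¬ Summable fun n => mass (killedLaw p d home y n) := by
  intro hs
  set a : ℕ → ℝ := fun n => mass (killedLaw p d home y n) with ha
  have hy : y ≠ home := by
    rintro rfl
    simp at hL
    omega
  have hf := firstHit_nonneg (d := d) (home := home) (y := y) h0 h1
  have ha0 : ∀ n, 0 ≤ a n := fun n => mass_nonneg (killedLaw_coeff_nonneg h0 h1 n)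
  have hanti : Antitone a := antitone_nat_of_succ_le fun n => by
    simp only [ha]
    rw [mass_killedLaw_succ hd]
    linarith [hf (n + 1)]
  have hK0 : 0 ≤ K := by
    refine le_trans ?_ (hB 0 n₀ le_rfl 0)
    exact mul_nonneg n₀.cast_nonneg (coeff_pathLaw_nonneg h0 h1 d _ _ 0)
  let g : ℕ → ℝ := fun t => (t : ℝ) *
    ∑ τ ∈ Finset.Ioc (t / 2) t, firstHit p d home y τ * (pathLaw p d τ t).coeff 0
  have hg : ∀ t, g t = t * (killedLaw p d home y (t / 2) * pathLaw p d (t / 2) t).coeff home :=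
    fun t => by rw [coeff_killedLaw_mul_pathLaw hy (Nat.div_le_self t 2)]
  have hg0 : ∀ t, 0 ≤ g t := fun t => mul_nonneg t.cast_nonneg <| Finset.sum_nonneg fun τ _ =>
    mul_nonneg (hf τ) (coeff_pathLaw_nonneg h0 h1 d τ t 0)
  have hgle : ∀ t, g t ≤ 2 * K * a (t / 2) := by
    intro t
    -- Before time 2n₀ home is out of reach; afterwards the free stretch t - ⌊t/2⌋ has at least n₀
    -- steps, so the local bound applies.
    rcases lt_or_ge t (2 * n₀) with ht | ht
    · have : g t = 0 := by
        simp only [g]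
        rw [Finset.sum_eq_zero, mul_zero]
        intro τ hτ
        have hτ' := (Finset.mem_Ioc.1 hτ).2
        rw [firstHit_eq_zero_of_lt (by omega), zero_mul]
      rw [this]
      have := ha0 (t / 2)
      positivity
    · rw [hg]
      obtain ⟨k, hk⟩ := Nat.exists_eq_add_of_le (Nat.div_le_self t 2)
      rcases Nat.eq_zero_or_pos k with hk0 | hk0
      · have : t = 0 := by omega
        subst this
        have := ha0 0
        simp only [Nat.cast_zero, zero_mul]
        positivity
      have hkr : (0 : ℝ) < k := by exact_mod_cast hk0
      have hcoef : ∀ z, (pathLaw p d (t / 2) t).coeff z ≤ K / k := by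
        intro z
        rw [le_div_iff₀ hkr, mul_comm]
        have := hB (t / 2) k (by omega) z
        rwa [← hk] at this
      have := coeff_mul_le_mass_mul (killedLaw_coeff_nonneg (d := d) (home := home) (y := y)
        h0 h1 (t / 2)) hcoef home
      have ht2 : (t : ℝ) ≤ 2 * k := by
        have : t ≤ 2 * k := by omega
        exact_mod_cast this
      calc (t : ℝ) * (killedLaw p d home y (t / 2) * pathLaw p d (t / 2) t).coeff home
          ≤ t * (a (t / 2) * (K / k)) := mul_le_mul_of_nonneg_left this t.cast_nonneg
        _ ≤ (2 * k) * (a (t / 2) * (K / k)) := by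
          have := ha0 (t / 2)
          gcongr
        _ = 2 * K * a (t / 2) := by field_simp
  have hpar : ∀ j, g (2 * j) = 0 ∨ g (2 * j + 1) = 0 := by
    have hz : ∀ t, g t ≠ 0 → (home.1 + home.2 - (y.1 + y.2) - t) % 2 = 0 := by
      intro t hne
      rw [hg] at hne
      obtain ⟨k, hk⟩ := Nat.exists_eq_add_of_le (Nat.div_le_self t 2)
      have := parity_of_coeff_killedLaw_mul_pathLaw_ne_zero (p := p) (d := d) (home := home)
        (y := y) (t / 2) k home
      rw [← hk] at this
      exact this (right_ne_zero_of_mul hne)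
    intro j
    by_contra! h
    have := hz _ h.1
    have := hz _ h.2
    push_cast at *
    omega
  have hpair : ∀ j, g (2 * j) + g (2 * j + 1) ≤ 2 * K * a j := by
    intro j
    have e1 := hgle (2 * j)
    have e2 := hgle (2 * j + 1)
    rw [show (2 * j) / 2 = j by omega] at e1
    rw [show (2 * j + 1) / 2 = j by omega] at e2
    rcases hpar j with h | h <;> rw [h] <;> linarith
  -- Truncated at N to keep all sums finite; the boundary term N a_N vanishes in the limit because
  -- `a` is antitone and summable.
  have hbound : ∀ N : ℕ, returnPoly p * (∑ j ∈ Finset.range N, a j - N * a N) ≤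
      2 * K * ∑' j, a j := by
    intro N
    have h := returnPoly_mul_sum_le (home := home) (y := y) h0 h1 hd (by omega) N
    rw [sum_mul_firstHit hd] at h
    refine h.trans ?_
    calc ∑ t ∈ Finset.range (N + 5), g t ≤ ∑ t ∈ Finset.range (2 * (N + 5)), g t :=
          Finset.sum_le_sum_of_subset_of_nonneg
            (Finset.range_subset_range.2 (by omega)) fun t _ _ => hg0 t
      _ = ∑ j ∈ Finset.range (N + 5), (g (2 * j) + g (2 * j + 1)) := sum_range_two_mul g _
      _ ≤ ∑ j ∈ Finset.range (N + 5), 2 * K * a j := Finset.sum_le_sum fun j _ => hpair j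
      _ = 2 * K * ∑ j ∈ Finset.range (N + 5), a j := by rw [Finset.mul_sum]
      _ ≤ 2 * K * ∑' j, a j := by
          gcongr
          exact hs.sum_le_tsum _ fun i _ => ha0 i
  have hlim := ((hs.hasSum.tendsto_sum_nat.sub
    (tendsto_mul_of_antitone_of_summable hanti ha0 hs)).const_mul (returnPoly p))
  have hfin := le_of_tendsto' hlim hbound
  -- The term at time 0 is 1, so the sum is positive and can be cancelled.
  have hpos : 1 ≤ ∑' j, a j := by
    have := hs.le_tsum 0 fun i _ => ha0 i
    refine le_trans (le_of_eq ?_) this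
    simp [ha, killedLaw, mass_single]
  rw [sub_zero] at hfin
  nlinarith

end Killed

/-! ### Fourier inversion and the uniform local bound -/

/-- The character of `ℤ²` with frequency `θ`. -/
noncomputable def gridChar (θ : ℝ × ℝ) : Multiplicative (ℤ × ℤ) →* ℂ where
  toFun z := Complex.exp (Complex.I * ((z.toAdd.1 : ℝ) * θ.1 + (z.toAdd.2 : ℝ) * θ.2 : ℝ))
  map_one' := by simp
  map_mul' z w := by
    rw [← Complex.exp_add]
    congr 1
    push_cast [toAdd_mul, Prod.fst_add, Prod.snd_add]
    ring

/-- The Fourier transform of an element of the group algebra of `ℤ²`. -/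
noncomputable def gridFourier (θ : ℝ × ℝ) : GridAlgebra →ₐ[ℝ] ℂ :=
  AddMonoidAlgebra.lift ℝ ℂ (ℤ × ℤ) (gridChar θ)

/-- The torus `[-π, π]²` of frequencies. -/
def freqBox : Set (ℝ × ℝ) :=
  Set.Icc (-Real.pi) Real.pi ×ˢ Set.Icc (-Real.pi) Real.pi

lemma isCompact_freqBox : IsCompact freqBox := isCompact_Icc.prod isCompact_Icc

lemma gridFourier_single (θ : ℝ × ℝ) (z : ℤ × ℤ) (r : ℝ) :
    gridFourier θ (AddMonoidAlgebra.single z r) =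
      r * Complex.exp (Complex.I * ((z.1 : ℝ) * θ.1 + (z.2 : ℝ) * θ.2 : ℝ)) := by
  simp [gridFourier, gridChar]

lemma continuous_gridFourier (u : GridAlgebra) : Continuous fun θ => gridFourier θ u := by
  induction u using AddMonoidAlgebra.induction_linear with
  | zero => simpa using continuous_const
  | add x y hx hy => simp only [map_add]; exact hx.add hy
  | single m r => simp only [gridFourier_single]; fun_prop

lemma integral_exp_int_mul (k : ℤ) :
    ∫ x in Set.Icc (-Real.pi) Real.pi, Complex.exp (Complex.I * ((k : ℝ) * x : ℝ)) =
      if k = 0 then 2 * (Real.pi : ℂ) else 0 := by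
  rw [integral_Icc_eq_integral_Ioc, ← intervalIntegral.integral_of_le (by linarith [Real.pi_pos])]
  split_ifs with hk
  · subst hk
    simp
    ring
  · have hc : (Complex.I * k : ℂ) ≠ 0 := by simp [hk]
    have := integral_exp_mul_complex (a := -Real.pi) (b := Real.pi) hc
    simp only [Complex.ofReal_mul, Complex.ofReal_intCast, ← mul_assoc]
    rw [this, div_eq_zero_iff, sub_eq_zero]
    left
    rw [Complex.exp_eq_exp_iff_exists_int]
    refine ⟨k, ?_⟩
    push_cast
    ring

/-- Fourier inversion on `ℤ²`. -/
lemma integral_gridFourier_mul (u : GridAlgebra) (z : ℤ × ℤ) :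
    ∫ θ in freqBox, gridFourier θ u *
        Complex.exp (Complex.I * (-((z.1 : ℝ) * θ.1 + (z.2 : ℝ) * θ.2) : ℝ)) =
      (4 * Real.pi ^ 2) * u.coeff z := by
  have hint : ∀ w : GridAlgebra, IntegrableOn (fun θ : ℝ × ℝ => gridFourier θ w *
      Complex.exp (Complex.I * (-((z.1 : ℝ) * θ.1 + (z.2 : ℝ) * θ.2) : ℝ))) freqBox := by
    intro w
    refine ContinuousOn.integrableOn_compact isCompact_freqBox (Continuous.continuousOn ?_)
    have := continuous_gridFourier w
    fun_prop
  induction u using AddMonoidAlgebra.induction_linear with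
  | zero => simp
  | add x y hx hy =>
    simp only [map_add, add_mul]
    rw [integral_add (hint x) (hint y), hx, hy]
    push_cast [AddMonoidAlgebra.coeff_add, Finsupp.add_apply]
    ring
  | single w r =>
    have h : ∀ θ : ℝ × ℝ, gridFourier θ (AddMonoidAlgebra.single w r) *
        Complex.exp (Complex.I * (-((z.1 : ℝ) * θ.1 + (z.2 : ℝ) * θ.2) : ℝ)) =
        r * (Complex.exp (Complex.I * (((w.1 - z.1 : ℤ) : ℝ) * θ.1 : ℝ)) *
          Complex.exp (Complex.I * (((w.2 - z.2 : ℤ) : ℝ) * θ.2 : ℝ))) := by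
      intro θ
      rw [gridFourier_single, mul_assoc, ← Complex.exp_add, ← Complex.exp_add]
      congr 2
      push_cast
      ring
    simp only [h]
    rw [integral_const_mul, freqBox, Measure.volume_eq_prod,
      setIntegral_prod_mul (fun x : ℝ => Complex.exp (Complex.I * (((w.1 - z.1 : ℤ) : ℝ) * x : ℝ)))
        (fun x : ℝ => Complex.exp (Complex.I * (((w.2 - z.2 : ℤ) : ℝ) * x : ℝ))),
      integral_exp_int_mul, integral_exp_int_mul, AddMonoidAlgebra.coeff_single,
      Finsupp.single_apply]
    by_cases hwz : w = z
    · subst hwz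
      simp
      ring
    · have : w.1 - z.1 ≠ 0 ∨ w.2 - z.2 ≠ 0 := by
        by_contra! h
        exact hwz (Prod.ext (by omega) (by omega))
      rcases this with h | h <;> simp [h, hwz]

lemma coeff_le_integral_norm_gridFourier (u : GridAlgebra) (z : ℤ × ℤ) :
    u.coeff z ≤ (4 * Real.pi ^ 2)⁻¹ * ∫ θ in freqBox, ‖gridFourier θ u‖ := by
  have h := norm_integral_le_integral_norm (μ := volume.restrict freqBox) fun θ : ℝ × ℝ =>
    gridFourier θ u * Complex.exp (Complex.I * (-((z.1 : ℝ) * θ.1 + (z.2 : ℝ) * θ.2) : ℝ))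
  rw [integral_gridFourier_mul] at h
  have hπ : 0 < 4 * Real.pi ^ 2 := by positivity
  have e : ‖((4 * Real.pi ^ 2) * u.coeff z : ℂ)‖ = 4 * Real.pi ^ 2 * |u.coeff z| := by
    rw [norm_mul, Complex.norm_real, Real.norm_eq_abs]
    congr 1
    rw [show (4 * Real.pi ^ 2 : ℂ) = ((4 * Real.pi ^ 2 : ℝ) : ℂ) by push_cast; ring,
      Complex.norm_real, Real.norm_of_nonneg hπ.le]
  rw [e] at h
  simp only [norm_mul, mul_comm Complex.I, Complex.norm_exp_ofReal_mul_I, mul_one] at h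
  rw [inv_mul_eq_div, le_div_iff₀ hπ, mul_comm]
  exact (mul_le_mul_of_nonneg_left (le_abs_self _) hπ.le).trans h

/-- The modulus of the Fourier transform of the law of a step with instruction `(±1, 0)`. -/
noncomputable def stepNorm (p s t : ℝ) : ℝ :=
  √(((1 - p / 2) * Real.cos s + p / 2 * Real.cos t) ^ 2 + ((1 - p) * Real.sin s) ^ 2)

lemma continuous_stepNorm (p : ℝ) : Continuous fun θ : ℝ × ℝ => stepNorm p θ.1 θ.2 := by
  unfold stepNorm
  fun_prop

lemma stepNorm_nonneg (p s t : ℝ) : 0 ≤ stepNorm p s t := Real.sqrt_nonneg _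

lemma gridFourier_stepLaw (p : ℝ) (d : ℤ × ℤ) (θ : ℝ × ℝ) : gridFourier θ (stepLaw p d) =
    (∑ v ∈ gridSteps, stepProb p d v * Real.cos (v.1 * θ.1 + v.2 * θ.2) : ℝ) +
      (∑ v ∈ gridSteps, stepProb p d v * Real.sin (v.1 * θ.1 + v.2 * θ.2) : ℝ) * Complex.I := by
  rw [stepLaw, map_sum, Complex.ofReal_sum, Complex.ofReal_sum, Finset.sum_mul,
    ← Finset.sum_add_distrib]
  refine Finset.sum_congr rfl fun v _ => ?_
  rw [gridFourier_single, mul_comm Complex.I, Complex.exp_mul_I]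
  push_cast
  ring

lemma norm_gridFourier_stepLaw (p : ℝ) {d : ℤ × ℤ} (hd : d ∈ gridSteps) :
    (∀ θ, ‖gridFourier θ (stepLaw p d)‖ = stepNorm p θ.1 θ.2) ∨
    (∀ θ, ‖gridFourier θ (stepLaw p d)‖ = stepNorm p θ.2 θ.1) := by
  simp only [gridFourier_stepLaw, Complex.norm_add_mul_I, stepNorm, sum_gridSteps, stepProb]
  rcases mem_gridSteps.1 hd with rfl | rfl | rfl | rfl
  · left; intro θ; simp [mem_gridSteps]; ring_nf
  · left; intro θ; simp [mem_gridSteps]; ring_nf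
  · right; intro θ; simp [mem_gridSteps]; ring_nf
  · right; intro θ; simp [mem_gridSteps]; ring_nf

/-- The bound on `n`-step displacement probabilities given by the Fourier transform. -/
noncomputable def fourierBound (p : ℝ) (n : ℕ) : ℝ :=
  (4 * Real.pi ^ 2)⁻¹ * ∫ θ in freqBox, stepNorm p θ.1 θ.2 ^ n

lemma integral_stepNorm_swap (p : ℝ) (n : ℕ) :
    ∫ θ in freqBox, stepNorm p θ.2 θ.1 ^ n = ∫ θ in freqBox, stepNorm p θ.1 θ.2 ^ n := by
  rw [freqBox, Measure.volume_eq_prod]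
  exact setIntegral_prod_swap (μ := volume) (ν := volume) (Set.Icc (-Real.pi) Real.pi)
    (Set.Icc (-Real.pi) Real.pi) fun θ : ℝ × ℝ => stepNorm p θ.1 θ.2 ^ n

/-- AM-GM applied to the powers `x i ^ s.card`. It separates the factors of a path's Fourier
transform, so that mixed instructions are no worse than constant ones. -/
lemma prod_le_sum_pow_div_card {ι : Type*} (s : Finset ι) (hs : s.Nonempty) (x : ι → ℝ)
    (hx : ∀ i ∈ s, 0 ≤ x i) : ∏ i ∈ s, x i ≤ ∑ i ∈ s, (s.card : ℝ)⁻¹ * x i ^ s.card := by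
  have hc : (s.card : ℝ) ≠ 0 := by exact_mod_cast hs.card_pos.ne'
  have h := Real.geom_mean_le_arith_mean_weighted s (fun _ => (s.card : ℝ)⁻¹)
    (fun i => x i ^ s.card) (fun i _ => by positivity) (by simp [hc])
    (fun i hi => pow_nonneg (hx i hi) _)
  refine le_trans (le_of_eq (Finset.prod_congr rfl fun i hi => ?_)) h
  rw [Real.pow_rpow_inv_natCast (hx i hi) hs.card_pos.ne']

/-- After AM-GM each summand involves one instruction only, and the symmetry of the torus under
swapping coordinates makes all their integrals equal. -/
lemma coeff_pathLaw_le_fourierBound {p : ℝ} {d : ℕ → ℤ × ℤ} (hd : ∀ i, d i ∈ gridSteps)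
    (m : ℕ) {k : ℕ} (hk : 0 < k) (z : ℤ × ℤ) :
    (pathLaw p d m (m + k)).coeff z ≤ fourierBound p k := by
  refine (coeff_le_integral_norm_gridFourier _ z).trans
    (mul_le_mul_of_nonneg_left ?_ (by positivity))
  have hcard : (Finset.Ico m (m + k)).card = k := by simp
  have hcont : ∀ i, Continuous fun θ => ‖gridFourier θ (stepLaw p (d i))‖ :=
    fun i => (continuous_gridFourier _).norm
  have hint : ∀ f : ℝ × ℝ → ℝ, Continuous f → IntegrableOn f freqBox := fun f hf =>
    hf.continuousOn.integrableOn_compact isCompact_freqBox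
  calc ∫ θ in freqBox, ‖gridFourier θ (pathLaw p d m (m + k))‖
      ≤ ∫ θ in freqBox, ∑ i ∈ Finset.Ico m (m + k),
          (k : ℝ)⁻¹ * ‖gridFourier θ (stepLaw p (d i))‖ ^ k := by
        refine integral_mono (hint _ (continuous_gridFourier _).norm) (hint _ (by fun_prop))
          fun θ => ?_
        have := prod_le_sum_pow_div_card (Finset.Ico m (m + k)) (by simpa using hk)
          (fun i => ‖gridFourier θ (stepLaw p (d i))‖) fun i _ => norm_nonneg _
        rw [hcard] at this
        simpa only [pathLaw, map_prod, norm_prod] using this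
    _ = ∑ i ∈ Finset.Ico m (m + k), (k : ℝ)⁻¹ * ∫ θ in freqBox, stepNorm p θ.1 θ.2 ^ k := by
        rw [integral_finsetSum _ fun i _ => hint _ (by fun_prop)]
        refine Finset.sum_congr rfl fun i _ => ?_
        rw [integral_const_mul]
        congr 1
        rcases norm_gridFourier_stepLaw p (hd i) with h | h
        · simp only [h]
        · simp only [h, integral_stepNorm_swap]
    _ = ∫ θ in freqBox, stepNorm p θ.1 θ.2 ^ k := by
        have : (k : ℝ) ≠ 0 := by exact_mod_cast hk.ne'
        simp [this]

/-! ### Folding the torus onto one maximum -/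

lemma stepNorm_add_two_pi_left (p x y : ℝ) :
    stepNorm p (x + 2 * Real.pi) y = stepNorm p x y := by
  simp [stepNorm]

lemma stepNorm_add_two_pi_right (p x y : ℝ) :
    stepNorm p x (y + 2 * Real.pi) = stepNorm p x y := by
  simp [stepNorm]

lemma stepNorm_add_pi_right (p x y : ℝ) :
    stepNorm p x (y + Real.pi) = stepNorm p (x + Real.pi) y := by
  simp only [stepNorm, Real.cos_add_pi, Real.sin_add_pi]
  congr 1
  ring

/-- Half of the torus of frequencies, a fundamental domain for the translation by `(π, π)`. -/
def halfBox : Set (ℝ × ℝ) :=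
  Set.Icc (-Real.pi) Real.pi ×ˢ Set.Icc (-(Real.pi / 2)) (Real.pi / 2)

lemma measurableSet_halfBox : MeasurableSet halfBox := measurableSet_Icc.prod measurableSet_Icc

lemma setIntegral_Icc_prod_Icc {f : ℝ × ℝ → ℝ} (hf : Continuous f) {a b c e : ℝ} (hab : a ≤ b)
    (hce : c ≤ e) :
    ∫ θ in Set.Icc a b ×ˢ Set.Icc c e, f θ = ∫ x in a..b, ∫ y in c..e, f (x, y) := by
  rw [Measure.volume_eq_prod, setIntegral_prod, intervalIntegral.integral_of_le hab,
    integral_Icc_eq_integral_Ioc]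
  · simp only [intervalIntegral.integral_of_le hce, integral_Icc_eq_integral_Ioc]
  · exact hf.continuousOn.integrableOn_compact (isCompact_Icc.prod isCompact_Icc)

/-- Translation by (π, π) negates the characteristic function because every step is odd. This
symmetry produces the factor 2 and leaves the origin as the only peak in `halfBox`. -/
lemma integral_freqBox_eq (p : ℝ) (n : ℕ) :
    ∫ θ in freqBox, stepNorm p θ.1 θ.2 ^ n = 2 * ∫ θ in halfBox, stepNorm p θ.1 θ.2 ^ n := by
  have hπ := Real.pi_pos
  have hc : Continuous fun θ : ℝ × ℝ => stepNorm p θ.1 θ.2 ^ n := (continuous_stepNorm p).pow n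
  have hcy : ∀ x, Continuous fun y => stepNorm p x y ^ n := by
    intro x
    unfold stepNorm
    fun_prop
  rw [freqBox, halfBox, setIntegral_Icc_prod_Icc hc (by linarith) (by linarith),
    setIntegral_Icc_prod_Icc hc (by linarith) (by linarith)]
  set J : ℝ → ℝ := fun x => ∫ y in -(Real.pi / 2)..Real.pi / 2, stepNorm p x y ^ n with hJ
  have hJc : Continuous J := by
    apply intervalIntegral.continuous_parametric_intervalIntegral_of_continuous'
    exact hc
  have hJper : Function.Periodic J (2 * Real.pi) := by
    intro x
    simp only [hJ, stepNorm_add_two_pi_left]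
  have hinner : ∀ x, ∫ y in -Real.pi..Real.pi, stepNorm p x y ^ n = J x + J (x + Real.pi) := by
    intro x
    have hper : Function.Periodic (fun y => stepNorm p x y ^ n) (2 * Real.pi) := by
      intro y
      simp only [stepNorm_add_two_pi_right]
    -- Shift the period to [-π/2, 3π/2] and cut it at π/2; the second half is the first one
    -- translated by π.
    have h1 := hper.intervalIntegral_add_eq (-Real.pi) (-(Real.pi / 2))
    rw [show -Real.pi + 2 * Real.pi = Real.pi by ring] at h1
    rw [h1, ← intervalIntegral.integral_add_adjacent_intervals
      ((hcy x).intervalIntegrable _ (Real.pi / 2)) ((hcy x).intervalIntegrable _ _)]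
    congr 1
    simp only [hJ, ← stepNorm_add_pi_right]
    rw [intervalIntegral.integral_comp_add_right (fun y => stepNorm p x y ^ n)]
    congr 1 <;> ring
  simp only [hinner]
  rw [intervalIntegral.integral_add (hJc.intervalIntegrable _ _)
    (Continuous.intervalIntegrable (by fun_prop) _ _),
    intervalIntegral.integral_comp_add_right J]
  have h2 := hJper.intervalIntegral_add_eq (-Real.pi) 0
  rw [show -Real.pi + 2 * Real.pi = Real.pi by ring, zero_add] at h2
  rw [show -Real.pi + Real.pi = 0 by ring, show Real.pi + Real.pi = 2 * Real.pi by ring, ← h2]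
  ring

/-! ### Laplace asymptotics -/

/-- Gaussian domination for the limit below. The characteristic function is (1-p)e^{iθ₁} + ps with s
the mean of the two cosines, so its modulus is at most 1 - p + p|s|. On `halfBox` s cannot approach
-1, since cos θ₂ ≥ 0. -/
lemma stepNorm_le_exp {p : ℝ} (h0 : 0 ≤ p) (h1 : p ≤ 1) {θ : ℝ × ℝ} (hθ : θ ∈ halfBox) :
    stepNorm p θ.1 θ.2 ≤ Real.exp (-(p / (4 * Real.pi ^ 2)) * (θ.1 ^ 2 + θ.2 ^ 2)) := by
  obtain ⟨⟨ha, hb⟩, ⟨hc, hd⟩⟩ := hθ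
  have hπ := Real.pi_pos
  have hx : θ.1 ^ 2 ≤ Real.pi ^ 2 := sq_le_sq' ha hb
  have hy : θ.2 ^ 2 ≤ (Real.pi / 2) ^ 2 := sq_le_sq' hc hd
  set r := (θ.1 ^ 2 + θ.2 ^ 2) / (4 * Real.pi ^ 2) with hr
  have hr0 : 0 ≤ r := by positivity
  have hrle : r ≤ 1 / 2 := by
    rw [hr, div_le_iff₀ (by positivity)]
    nlinarith
  have c1 := Real.cos_le_one_sub_mul_cos_sq (abs_le.2 ⟨ha, hb⟩)
  have c2 := Real.cos_le_one_sub_mul_cos_sq (x := θ.2) (abs_le.2 ⟨by linarith, by linarith⟩)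
  have c3 := Real.cos_nonneg_of_neg_pi_div_two_le_of_le (x := θ.2) (by linarith) hd
  have c4 := Real.neg_one_le_cos θ.1
  set c := Real.cos θ.1
  set e := Real.cos θ.2
  set s := (c + e) / 2 with hs
  have hsum : 2 / Real.pi ^ 2 * θ.1 ^ 2 + 2 / Real.pi ^ 2 * θ.2 ^ 2 = 8 * r := by
    rw [hr]; field_simp; ring
  have hsle : |s| ≤ 1 - r := abs_le.2 ⟨by linarith, by linarith⟩
  have hsin : Real.sin θ.1 ^ 2 = 1 - c ^ 2 := Real.sin_sq θ.1
  have hc1 : |c| ≤ 1 := Real.abs_cos_le_one _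
  have hcs : c * s ≤ |s| := by
    calc c * s ≤ |c * s| := le_abs_self _
      _ = |c| * |s| := abs_mul _ _
      _ ≤ 1 * |s| := by gcongr
      _ = |s| := one_mul _
  have hq : 0 ≤ 1 - p := by linarith
  have hle : stepNorm p θ.1 θ.2 ≤ (1 - p) + p * |s| := by
    apply Real.sqrt_le_iff.2
    refine ⟨by positivity, ?_⟩
    have e1 : ((1 - p / 2) * c + p / 2 * e) ^ 2 + ((1 - p) * Real.sin θ.1) ^ 2 =
        (1 - p) ^ 2 + 2 * (p * (1 - p)) * (c * s) + p ^ 2 * s ^ 2 := by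
      rw [mul_pow, hsin, hs]; ring
    have e2 := mul_le_mul_of_nonneg_left hcs (mul_nonneg h0 hq)
    rw [e1]
    nlinarith [sq_abs s]
  calc stepNorm p θ.1 θ.2 ≤ (1 - p) + p * |s| := hle
    _ ≤ -(p * r) + 1 := by nlinarith
    _ ≤ Real.exp (-(p * r)) := Real.add_one_le_exp _
    _ = _ := by congr 1; rw [hr]; ring

lemma tendsto_mul_one_sub_cos (w : ℝ) :
    Filter.Tendsto (fun n : ℕ => (n : ℝ) * (1 - Real.cos ((√(n : ℝ))⁻¹ * w))) Filter.atTop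
      (nhds (w ^ 2 / 2)) := by
  have hev : ∀ᶠ n : ℕ in Filter.atTop, w ^ 2 < n ∧ (0 : ℝ) < n :=
    (tendsto_natCast_atTop_atTop.eventually_gt_atTop (w ^ 2)).and
      (tendsto_natCast_atTop_atTop.eventually_gt_atTop (0 : ℝ))
  have hlim : Filter.Tendsto (fun n : ℕ => w ^ 4 * (5 / 96) / (n : ℝ)) Filter.atTop (nhds 0) :=
    tendsto_const_div_atTop_nhds_zero_nat _
  rw [tendsto_iff_norm_sub_tendsto_zero]
  refine squeeze_zero' (Filter.Eventually.of_forall fun n => norm_nonneg _) ?_ hlim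
  filter_upwards [hev] with n hn
  obtain ⟨hn1, hn0⟩ := hn
  have hsq : ((√(n : ℝ))⁻¹ * w) ^ 2 = w ^ 2 / n := by
    rw [mul_pow, inv_pow, Real.sq_sqrt hn0.le]; ring
  set x := (√(n : ℝ))⁻¹ * w
  have hx1 : |x| ≤ 1 := by
    rw [← sq_le_one_iff_abs_le_one, hsq, div_le_one hn0]
    exact hn1.le
  have hb := Real.cos_bound hx1
  have hx4 : |x| ^ 4 = w ^ 4 / n ^ 2 := by
    rw [show |x| ^ 4 = (|x| ^ 2) ^ 2 by ring, sq_abs, hsq]; ring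
  rw [hx4] at hb
  have e : (n : ℝ) * (1 - Real.cos x) - w ^ 2 / 2 = -(n * (Real.cos x - (1 - x ^ 2 / 2))) := by
    rw [hsq]; field_simp; ring
  rw [e, norm_neg, norm_mul, Real.norm_eq_abs, Real.norm_eq_abs, abs_of_pos hn0]
  calc (n : ℝ) * |Real.cos x - (1 - x ^ 2 / 2)| ≤ n * (w ^ 4 / n ^ 2 * (5 / 96)) := by gcongr
    _ = w ^ 4 * (5 / 96) / n := by field_simp

/-- The squared modulus is 1 + e_n, where n e_n converges by the second-order expansion of the
cosine; hence its n-th power tends to an exponential. -/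
lemma tendsto_stepNorm_pow (p : ℝ) (w : ℝ × ℝ) :
    Filter.Tendsto (fun n : ℕ => stepNorm p ((√(n : ℝ))⁻¹ * w.1) ((√(n : ℝ))⁻¹ * w.2) ^ n)
      Filter.atTop
      (nhds (Real.exp (-(p * (3 - 2 * p) / 4) * w.1 ^ 2) * Real.exp (-(p / 4) * w.2 ^ 2))) := by
  let δ : ℝ → ℕ → ℝ := fun x n => 1 - Real.cos ((√(n : ℝ))⁻¹ * x)
  have hnδ : ∀ x, Filter.Tendsto (fun n : ℕ => (n : ℝ) * δ x n) Filter.atTop (nhds (x ^ 2 / 2)) :=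
    tendsto_mul_one_sub_cos
  have hδ : ∀ x, Filter.Tendsto (δ x) Filter.atTop (nhds 0) := by
    intro x
    have h0 : Filter.Tendsto (fun n : ℕ => (√(n : ℝ))⁻¹ * x) Filter.atTop (nhds 0) := by
      have := (tendsto_inv_atTop_zero.comp
        (Real.tendsto_sqrt_atTop.comp tendsto_natCast_atTop_atTop)).mul_const x
      simpa using this
    have := (Real.continuous_cos.tendsto 0).comp h0
    rw [Real.cos_zero] at this
    simpa using this.const_sub 1
  let e : ℕ → ℝ := fun n => -2 * ((1 - p / 2) * δ w.1 n + p / 2 * δ w.2 n)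
    + ((1 - p / 2) * δ w.1 n + p / 2 * δ w.2 n) ^ 2 + (1 - p) ^ 2 * (2 * δ w.1 n - δ w.1 n ^ 2)
  have he : ∀ n : ℕ, stepNorm p ((√(n : ℝ))⁻¹ * w.1) ((√(n : ℝ))⁻¹ * w.2) = √(1 + e n) := by
    intro n
    rw [stepNorm, mul_pow (1 - p), Real.sin_sq]
    congr 1
    simp only [e, δ]
    ring
  have hlim : Filter.Tendsto (fun n : ℕ => (n : ℝ) * e n) Filter.atTop
      (nhds (-(p * (3 - 2 * p) / 2) * w.1 ^ 2 + -(p / 2) * w.2 ^ 2)) := by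
    have hA := ((hnδ w.1).const_mul (1 - p / 2)).add ((hnδ w.2).const_mul (p / 2))
    have hA0 := ((hδ w.1).const_mul (1 - p / 2)).add ((hδ w.2).const_mul (p / 2))
    have h := ((hA.const_mul (-2)).add (hA.mul hA0)).add
      ((((hnδ w.1).const_mul 2).sub ((hnδ w.1).mul (hδ w.1))).const_mul ((1 - p) ^ 2))
    refine (h.congr fun n => ?_).trans_eq ?_
    · simp only [e]; ring
    · congr 1; ring
  have hpow := (Real.continuous_sqrt.tendsto _).comp (Real.tendsto_one_add_pow_exp_of_tendsto hlim)
  have hval : √(Real.exp (-(p * (3 - 2 * p) / 2) * w.1 ^ 2 + -(p / 2) * w.2 ^ 2)) =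
      Real.exp (-(p * (3 - 2 * p) / 4) * w.1 ^ 2) * Real.exp (-(p / 4) * w.2 ^ 2) := by
    rw [Real.sqrt_eq_iff_mul_self_eq (by positivity) (by positivity), ← Real.exp_add,
      ← Real.exp_add]
    congr 1
    ring
  rw [hval] at hpow
  have hpos : ∀ᶠ n in Filter.atTop, 0 ≤ 1 + e n := by
    refine Filter.Eventually.of_forall fun n => ?_
    have : 1 + e n = ((1 - p / 2) * Real.cos ((√(n : ℝ))⁻¹ * w.1)
        + p / 2 * Real.cos ((√(n : ℝ))⁻¹ * w.2)) ^ 2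
        + ((1 - p) * Real.sin ((√(n : ℝ))⁻¹ * w.1)) ^ 2 := by
      rw [mul_pow (1 - p), Real.sin_sq]
      simp only [e, δ]
      ring
    rw [this]
    positivity
  refine hpow.congr' ?_
  filter_upwards [hpos] with n hn
  rw [he, Function.comp_apply]
  exact (Real.sqrt_eq_iff_mul_self_eq (by positivity) (by positivity)).2
    (by rw [← mul_pow, Real.mul_self_sqrt hn])

lemma halfBox_mem_nhds : halfBox ∈ nhds (0 : ℝ × ℝ) := by
  have hπ := Real.pi_pos
  exact prod_mem_nhds (Icc_mem_nhds (by simpa using hπ) (by simpa using hπ))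
    (Icc_mem_nhds (by simpa using hπ) (by simpa using hπ))

/-- Rescaling by √n in the plane absorbs the factor n, and dominated convergence leaves a Gaussian
integral. -/
lemma tendsto_mul_integral_halfBox {p : ℝ} (h0 : 0 < p) (h1 : p ≤ 1) :
    Filter.Tendsto (fun n : ℕ => (n : ℝ) * ∫ θ in halfBox, stepNorm p θ.1 θ.2 ^ n) Filter.atTop
      (nhds (4 * Real.pi / (p * √(3 - 2 * p)))) := by
  have hπ := Real.pi_pos
  set c := p / (4 * Real.pi ^ 2) with hc
  have hc0 : 0 < c := by positivity
  let F : ℕ → ℝ × ℝ → ℝ := fun n => halfBox.indicator fun θ => stepNorm p θ.1 θ.2 ^ n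
  have hscale : ∀ n : ℕ, ∫ w, F n ((√(n : ℝ))⁻¹ • w) =
      (n : ℝ) * ∫ θ in halfBox, stepNorm p θ.1 θ.2 ^ n := by
    intro n
    rw [Measure.integral_comp_smul, ← integral_indicator measurableSet_halfBox, smul_eq_mul]
    congr 1
    have : Module.finrank ℝ (ℝ × ℝ) = 2 := by simp
    rw [this, inv_pow, Real.sq_sqrt n.cast_nonneg, inv_inv, abs_of_nonneg n.cast_nonneg]
  have hgauss : ∫ w : ℝ × ℝ, Real.exp (-(p * (3 - 2 * p) / 4) * w.1 ^ 2) *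
      Real.exp (-(p / 4) * w.2 ^ 2) = 4 * Real.pi / (p * √(3 - 2 * p)) := by
    have h3 : 0 < 3 - 2 * p := by linarith
    rw [Measure.volume_eq_prod, integral_prod_mul (fun x : ℝ => Real.exp (-(p * (3 - 2 * p) / 4) *
      x ^ 2)) (fun x : ℝ => Real.exp (-(p / 4) * x ^ 2)), integral_gaussian, integral_gaussian,
      ← Real.sqrt_mul (by positivity), Real.sqrt_eq_iff_mul_self_eq (by positivity) (by positivity)]
    have hs : √(3 - 2 * p) ^ 2 = 3 - 2 * p := Real.sq_sqrt h3.le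
    rw [div_mul_div_comm (4 * Real.pi), show p * √(3 - 2 * p) * (p * √(3 - 2 * p)) = p ^ 2 * √(3 - 2 * p) ^ 2 by
      ring, hs]
    field_simp
  simp only [← hscale]
  rw [← hgauss]
  refine tendsto_integral_filter_of_dominated_convergence
    (fun w : ℝ × ℝ => Real.exp (-c * w.1 ^ 2) * Real.exp (-c * w.2 ^ 2)) ?_ ?_ ?_ ?_
  · refine Filter.Eventually.of_forall fun n => ?_
    have hm : Measurable (F n) :=
      ((continuous_stepNorm p).pow n).measurable.indicator measurableSet_halfBox
    exact (hm.comp (measurable_const_smul _)).aestronglyMeasurable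
  · filter_upwards [Filter.eventually_gt_atTop 0] with n hn
    refine Filter.Eventually.of_forall fun w => ?_
    have hn' : (0 : ℝ) < n := by exact_mod_cast hn
    by_cases hw : (√(n : ℝ))⁻¹ • w ∈ halfBox
    · simp only [F, Set.indicator_of_mem hw]
      rw [norm_pow, Real.norm_of_nonneg (stepNorm_nonneg _ _ _)]
      refine (pow_le_pow_left₀ (stepNorm_nonneg _ _ _) (stepNorm_le_exp h0.le h1 hw) n).trans ?_
      rw [← Real.exp_nat_mul, ← Real.exp_add, ← hc]
      apply le_of_eq
      congr 1
      simp only [Prod.smul_fst, Prod.smul_snd, smul_eq_mul, mul_pow, inv_pow,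
        Real.sq_sqrt hn'.le]
      field_simp
      ring
    · simp only [F, Set.indicator_of_notMem hw, norm_zero]
      positivity
  · rw [Measure.volume_eq_prod]
    exact (integrable_exp_neg_mul_sq hc0).mul_prod (integrable_exp_neg_mul_sq hc0)
  · refine Filter.Eventually.of_forall fun w => ?_
    refine (tendsto_stepNorm_pow p w).congr' ?_
    have hz : Filter.Tendsto (fun n : ℕ => (√(n : ℝ))⁻¹ • w) Filter.atTop (nhds 0) := by
      have := (tendsto_inv_atTop_zero.comp
        (Real.tendsto_sqrt_atTop.comp tendsto_natCast_atTop_atTop)).smul_const w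
      simpa using this
    filter_upwards [hz.eventually_mem halfBox_mem_nhds] with n hn
    simp only [F]
    rw [Set.indicator_of_mem hn]
    rfl

/-- The sharp constant in the local limit bound. -/
lemma tendsto_mul_fourierBound {p : ℝ} (h0 : 0 < p) (h1 : p ≤ 1) :
    Filter.Tendsto (fun n : ℕ => (n : ℝ) * fourierBound p n) Filter.atTop
      (nhds (2 / (Real.pi * p * √(3 - 2 * p)))) := by
  have h := (tendsto_mul_integral_halfBox h0 h1).const_mul ((4 * Real.pi ^ 2)⁻¹ * 2)
  have hπ := Real.pi_pos
  have h3 : 0 < √(3 - 2 * p) := Real.sqrt_pos.2 (by linarith)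
  refine (h.congr fun n => ?_).trans_eq ?_
  · rw [fourierBound, integral_freqBox_eq]
    ring
  · congr 1
    field_simp

/-! ### Transfer to the walk on a probability space -/

section Walk

variable {Ω : Type*} [MeasurableSpace Ω] {μ : Measure Ω} {p : ℝ} {x : ℕ → ℤ × ℤ}
  {X : ℕ → Ω → ℤ × ℤ}

/-- The event that the walk is at `z` at time `n` and has not visited `home` so far. -/
def survivalEvent (X : ℕ → Ω → ℤ × ℤ) (home : ℤ × ℤ) (n : ℕ) (z : ℤ × ℤ) : Set Ω :=
  {ω | X n ω = z ∧ ∀ i ≤ n, X i ω ≠ home}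

lemma IsGuidedRandomWalk.measurableSet_survivalEvent (hX : IsGuidedRandomWalk μ p x X)
    (home : ℤ × ℤ) (n : ℕ) (z : ℤ × ℤ) : MeasurableSet (survivalEvent X home n z) := by
  have h : survivalEvent X home n z = X n ⁻¹' {z} ∩ ⋂ i ∈ Set.Iic n, X i ⁻¹' {home}ᶜ := by
    ext ω
    simp [survivalEvent]
  rw [h]
  exact (hX.measurable n (measurableSet_singleton z)).inter
    (MeasurableSet.biInter (Set.to_countable _) fun i _ =>
      hX.measurable i (measurableSet_singleton home).compl)

/-- The Markov property is given for complete trajectories, so the event is split into the countably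
many histories up to time `n`. -/
lemma IsGuidedRandomWalk.measure_survivalEvent_inter (hX : IsGuidedRandomWalk μ p x X)
    (home : ℤ × ℤ) (n : ℕ) (z z' : ℤ × ℤ) :
    μ (survivalEvent X home n z ∩ X (n + 1) ⁻¹' {z'}) =
      μ (survivalEvent X home n z) * ENNReal.ofReal (stepProb p (x (n + 1) - x n) (z' - z)) := by
  let Φ : Ω → (Fin (n + 1) → ℤ × ℤ) := fun ω i => X i ω
  have hΦ : Measurable Φ := measurable_pi_lambda _ fun i => hX.measurable i
  let S : Set (Fin (n + 1) → ℤ × ℤ) := {q | q (Fin.last n) = z ∧ ∀ i, q i ≠ home}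
  have hS : survivalEvent X home n z = ⋃ q ∈ S, Φ ⁻¹' {q} := by
    ext ω
    simp only [survivalEvent, Set.mem_ofPred_eq, S, Set.mem_iUnion, Set.mem_preimage,
      Set.mem_singleton_iff, exists_prop, Φ]
    constructor
    · rintro ⟨h1, h2⟩
      exact ⟨_, ⟨by simpa using h1, fun i => h2 i (by omega)⟩, rfl⟩
    · rintro ⟨q, ⟨h1, h2⟩, rfl⟩
      exact ⟨by simpa using h1, fun i hi => h2 ⟨i, by omega⟩⟩
  have hdisj : S.PairwiseDisjoint fun q => Φ ⁻¹' {q} := by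
    intro q _ r _ hqr
    exact Disjoint.preimage Φ (by simpa using hqr)
  have hmeas : ∀ q, MeasurableSet (Φ ⁻¹' {q}) := fun q => hΦ (measurableSet_singleton q)
  have hmeas' : MeasurableSet (X (n + 1) ⁻¹' {z'}) :=
    hX.measurable _ (measurableSet_singleton z')
  rw [hS, Set.iUnion₂_inter, measure_biUnion S.to_countable hdisj fun q _ => hmeas q,
    measure_biUnion S.to_countable
      (hdisj.mono fun q => Set.inter_subset_left) fun q _ => (hmeas q).inter hmeas',
    ← ENNReal.tsum_mul_right]
  refine tsum_congr fun ⟨q, hq⟩ => ?_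
  let y : ℕ → ℤ × ℤ := fun i => if h : i < n + 1 then q ⟨i, h⟩ else z'
  have h1 : Φ ⁻¹' {q} = {ω | ∀ i ≤ n, X i ω = y i} := by
    ext ω
    simp only [Set.mem_preimage, Set.mem_singleton_iff, Set.mem_ofPred_eq, Φ, funext_iff]
    constructor
    · intro h i hi
      simp only [y, show i < n + 1 by omega, dif_pos]
      exact h ⟨i, by omega⟩
    · intro h i
      have := h i (by omega)
      simpa only [y, i.isLt, dif_pos] using this
  have h2 : Φ ⁻¹' {q} ∩ X (n + 1) ⁻¹' {z'} = {ω | ∀ i ≤ n + 1, X i ω = y i} := by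
    rw [h1]
    ext ω
    simp only [Set.mem_inter_iff, Set.mem_ofPred_eq, Set.mem_preimage, Set.mem_singleton_iff]
    have hy : y (n + 1) = z' := by simp [y]
    constructor
    · rintro ⟨h, h'⟩ i hi
      rcases Nat.lt_or_ge n i with hlt | hge
      · obtain rfl : i = n + 1 := by omega
        rw [h', hy]
      · exact h i hge
    · intro h
      exact ⟨fun i hi => h i (by omega), (h _ le_rfl).trans hy⟩
  have hyn : y (n + 1) - y n = z' - z := by
    have : y n = z := by
      rw [← hq.1]
      simp [y, Fin.last]
    rw [this]
    simp [y]
  rw [h2, hX.markov n y, ← h1, hyn]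

lemma IsGuidedRandomWalk.sum_le_measure_survivalEvent_succ (hX : IsGuidedRandomWalk μ p x X)
    {home z : ℤ × ℤ} (hz : z ≠ home) (n : ℕ) :
    ∑ v ∈ gridSteps, μ (survivalEvent X home n (z - v)) *
        ENNReal.ofReal (stepProb p (x (n + 1) - x n) v) ≤
      μ (survivalEvent X home (n + 1) z) := by
  have h : ∀ v ∈ gridSteps, μ (survivalEvent X home n (z - v)) *
        ENNReal.ofReal (stepProb p (x (n + 1) - x n) v) =
      μ (survivalEvent X home n (z - v) ∩ X (n + 1) ⁻¹' {z}) := by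
    intro v _
    rw [hX.measure_survivalEvent_inter, sub_sub_cancel]
  rw [Finset.sum_congr rfl h, ← measure_biUnion_finset]
  · refine measure_mono ?_
    intro ω hω
    simp only [Set.mem_iUnion, exists_prop] at hω
    obtain ⟨v, _, ⟨h1, h2⟩, h3⟩ := hω
    rw [Set.mem_preimage, Set.mem_singleton_iff] at h3
    refine ⟨h3, fun i hi => ?_⟩
    rcases Nat.lt_or_ge n i with hlt | hge
    · obtain rfl : i = n + 1 := by omega
      rw [h3]
      exact hz
    · exact h2 i hge
  · intro v _ w _ hvw
    refine Set.disjoint_left.2 fun ω hv hw => hvw ?_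
    have e := hv.1.1.symm.trans hw.1.1
    exact sub_right_injective e
  · exact fun v _ => (hX.measurableSet_survivalEvent home n _).inter
      (hX.measurable _ (measurableSet_singleton z))

/-- Restarting at time `s` from `y` shifts the instructions. An inequality suffices, because other
histories only add to the survival probability. -/
lemma IsGuidedRandomWalk.killedLaw_le (hX : IsGuidedRandomWalk μ p x X) (h0 : 0 ≤ p) (h1 : p ≤ 1)
    {home y : ℤ × ℤ} (hy : y ≠ home) (s k : ℕ) : ∀ z,
    μ (survivalEvent X home s y) * ENNReal.ofReal
        ((killedLaw p (fun i => x (s + i + 1) - x (s + i)) home y k).coeff z) ≤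
      μ (survivalEvent X home (s + k) z) := by
  induction k with
  | zero =>
    intro z
    rw [killedLaw, AddMonoidAlgebra.coeff_single, Finsupp.single_apply]
    split_ifs with h
    · subst h
      simp
    · simp
  | succ k ih =>
    intro z
    by_cases hz : z = home
    · subst hz
      rw [killedLaw_coeff_home hy]
      simp
    · rw [killedLaw, AddMonoidAlgebra.coeff_erase, Finsupp.erase_ne hz, coeff_mul_stepLaw,
        ENNReal.ofReal_sum_of_nonneg fun v _ => mul_nonneg (killedLaw_coeff_nonneg h0 h1 k _)
          (stepProb_nonneg h0 h1 _ _), Finset.mul_sum]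
      refine le_trans (Finset.sum_le_sum fun v _ => ?_)
        (hX.sum_le_measure_survivalEvent_succ hz (s + k))
      rw [ENNReal.ofReal_mul (killedLaw_coeff_nonneg h0 h1 k _), ← mul_assoc]
      exact mul_le_mul_left (ih _) _

lemma IsGuidedRandomWalk.mass_killedLaw_le (hX : IsGuidedRandomWalk μ p x X) (h0 : 0 ≤ p)
    (h1 : p ≤ 1) {home y : ℤ × ℤ} (hy : y ≠ home) (s k : ℕ) :
    μ (survivalEvent X home s y) * ENNReal.ofReal
        (mass (killedLaw p (fun i => x (s + i + 1) - x (s + i)) home y k)) ≤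
      μ {ω | ∀ i ≤ s + k, X i ω ≠ home} := by
  rw [mass_eq_sum, Finsupp.sum,
    ENNReal.ofReal_sum_of_nonneg fun z _ => killedLaw_coeff_nonneg h0 h1 k z, Finset.mul_sum]
  refine (Finset.sum_le_sum fun z _ => hX.killedLaw_le h0 h1 hy s k z).trans ?_
  rw [← measure_biUnion_finset]
  · refine measure_mono ?_
    intro ω hω
    simp only [Set.mem_iUnion, exists_prop] at hω
    obtain ⟨z, _, hz⟩ := hω
    exact hz.2
  · intro v _ w _ hvw
    exact Set.disjoint_left.2 fun ω hv hw => hvw (hv.1.symm.trans hw.1)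
  · exact fun z _ => hX.measurableSet_survivalEvent home _ z

/-- With positive probability the walk moves straight away from home. -/
lemma IsGuidedRandomWalk.exists_far [IsProbabilityMeasure μ] (hX : IsGuidedRandomWalk μ p x X)
    (h0 : 0 < p) (h1 : p ≤ 1) {home : ℤ × ℤ} (hhome : home ≠ 0) (n : ℕ) :
    ∃ y, (n : ℤ) ≤ |home.1 - y.1| + |home.2 - y.2| ∧ y ≠ home ∧
      μ (survivalEvent X home n y) ≠ 0 := by
  -- A horizontal direction pointing away from home; an error produces the step `e` with probability
  -- p/4 whatever the instruction.
  obtain ⟨e, he, hne, hfar⟩ : ∃ e ∈ gridSteps, (∀ k : ℕ, k • e ≠ home) ∧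
      ∀ k : ℕ, (k : ℤ) ≤ |home.1 - (k • e).1| + |home.2 - (k • e).2| := by
    rcases le_or_gt home.1 0 with hh | hh
    · refine ⟨(1, 0), by simp [gridSteps], fun k hk => ?_, fun k => ?_⟩
      · have e1 := congrArg Prod.fst hk
        have e2 := congrArg Prod.snd hk
        simp at e1 e2
        exact hhome (Prod.ext (by simp; omega) (by simp; omega))
      · have := neg_le_abs (home.1 - k)
        have := abs_nonneg home.2
        simp
        linarith
    · refine ⟨(-1, 0), by simp [gridSteps], fun k hk => ?_, fun k => ?_⟩
      · have e1 := congrArg Prod.fst hk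
        simp at e1
        omega
      · have := le_abs_self (home.1 + k)
        have := abs_nonneg home.2
        simp
        linarith
  refine ⟨n • e, hfar n, hne n, ?_⟩
  induction n with
  | zero =>
    have : survivalEvent X home 0 (0 • e) =ᵐ[μ] Set.univ := by
      filter_upwards [hX.start] with ω hω
      have : ω ∈ survivalEvent X home 0 (0 • e) := by
        simp only [survivalEvent, Set.mem_ofPred_eq, zero_smul]
        refine ⟨hω, fun i hi => ?_⟩
        obtain rfl : i = 0 := by omega
        rw [hω]
        exact hhome.symm
      exact eq_true this
    rw [measure_congr this]
    simp
  | succ n ih =>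
    have h := hX.sum_le_measure_survivalEvent_succ (hne (n + 1)) n
    have h' := (Finset.single_le_sum (f := fun v => μ (survivalEvent X home n ((n + 1) • e - v)) *
      ENNReal.ofReal (stepProb p (x (n + 1) - x n) v)) (fun _ _ => zero_le) he).trans h
    simp only [add_smul, one_smul, add_sub_cancel_right] at h' ⊢
    refine ne_of_gt (lt_of_lt_of_le ?_ h')
    refine ENNReal.mul_pos ih ?_
    rw [ne_eq, ENNReal.ofReal_eq_zero, not_le]
    unfold stepProb
    rw [if_pos he]
    have : 0 ≤ (1 - p) * (if e = x (n + 1) - x n then (1 : ℝ) else 0) := by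
      have : 0 ≤ 1 - p := by linarith
      split_ifs <;> simp [this]
    linarith

/-- Tail-sum formula: each n < T contributes 1 to T. -/
lemma IsGuidedRandomWalk.tsum_le_lintegral_hitTime (hX : IsGuidedRandomWalk μ p x X)
    (home : ℤ × ℤ) :
    ∑' n : ℕ, μ {ω | ∀ i ≤ n, X i ω ≠ home} ≤ ∫⁻ ω, hitTime X home ω ∂μ := by
  have hm : ∀ n : ℕ, MeasurableSet {ω | ∀ i ≤ n, X i ω ≠ home} := by
    intro n
    have h : {ω | ∀ i ≤ n, X i ω ≠ home} = ⋂ i ∈ Set.Iic n, X i ⁻¹' {home}ᶜ := by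
      ext ω
      simp
    rw [h]
    exact MeasurableSet.biInter (Set.to_countable _) fun i _ =>
      hX.measurable i (measurableSet_singleton home).compl
  have h : ∀ n : ℕ, μ {ω | ∀ i ≤ n, X i ω ≠ home} =
      ∫⁻ ω, {ω | ∀ i ≤ n, X i ω ≠ home}.indicator 1 ω ∂μ := fun n =>
    (lintegral_indicator_one (hm n)).symm
  simp only [h]
  rw [← lintegral_tsum fun n => (measurable_one.indicator (hm n)).aemeasurable]
  refine lintegral_mono fun ω => le_iInf₂ fun t ht => ?_
  rw [tsum_eq_sum (s := Finset.range t)]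
  · calc ∑ n ∈ Finset.range t, {ω | ∀ i ≤ n, X i ω ≠ home}.indicator (1 : Ω → ℝ≥0∞) ω
        ≤ ∑ n ∈ Finset.range t, 1 :=
          Finset.sum_le_sum fun n _ => Set.indicator_le_self' (fun _ _ => zero_le) ω
      _ = t := by simp
  · intro n hn
    refine Set.indicator_of_notMem (fun hω => ?_) _
    exact hω t (by simpa using hn) ht

/-- If the local bound holds with constant `K < R₄(p) / 2`, home is entered in infinite mean
time. -/
lemma IsGuidedRandomWalk.lintegral_hitTime_eq_top [IsProbabilityMeasure μ]
    (hX : IsGuidedRandomWalk μ p x X) (hx : IsInstructionSequence x) (h0 : 0 < p) (h1 : p ≤ 1)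
    {home : ℤ × ℤ} (hhome : home ≠ 0)
    (hp : 2 * (2 / (Real.pi * p * √(3 - 2 * p))) < returnPoly p) :
    ∫⁻ ω, hitTime X home ω ∂μ = ∞ := by
  obtain ⟨K, hK1, hK2⟩ := exists_between (show 2 / (Real.pi * p * √(3 - 2 * p)) < returnPoly p / 2
    by linarith)
  obtain ⟨n₁, hn₁⟩ := Filter.eventually_atTop.1
    ((tendsto_mul_fourierBound h0 h1).eventually_lt_const hK1)
  -- The successor makes k positive, as the Fourier bound requires.
  set n₀ := n₁ + 1
  obtain ⟨y, hfar, hy, hpos⟩ := hX.exists_far h0 h1 hhome (2 * n₀ + 5)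
  set s := 2 * n₀ + 5 with hs
  set d : ℕ → ℤ × ℤ := fun i => x (s + i + 1) - x (s + i) with hd
  have hns : ¬ Summable fun k => mass (killedLaw p d home y k) := by
    refine not_summable_mass_killedLaw (K := K) (n₀ := n₀) h0.le h1 (fun i => hx.step _) ?_
      (by linarith) (by exact_mod_cast hfar)
    intro m k hk z
    refine le_trans ?_ (hn₁ k (by omega)).le
    exact mul_le_mul_of_nonneg_left
      (coeff_pathLaw_le_fourierBound (fun i => hx.step _) m (by omega) z) k.cast_nonneg
  by_contra hne
  apply hns
  have hle : μ (survivalEvent X home s y) *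
      ∑' k, ENNReal.ofReal (mass (killedLaw p d home y k)) ≤ ∫⁻ ω, hitTime X home ω ∂μ := by
    rw [← ENNReal.tsum_mul_left]
    calc _ ≤ ∑' k : ℕ, μ {ω | ∀ i ≤ s + k, X i ω ≠ home} :=
          ENNReal.tsum_le_tsum fun k => hX.mass_killedLaw_le h0.le h1 hy s k
      _ ≤ ∑' n : ℕ, μ {ω | ∀ i ≤ n, X i ω ≠ home} :=
          ENNReal.tsum_comp_le_tsum_of_injective (add_right_injective s) _
      _ ≤ _ := hX.tsum_le_lintegral_hitTime home
  have hfin : ∑' k, ENNReal.ofReal (mass (killedLaw p d home y k)) ≠ ∞ := by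
    intro htop
    rw [htop, ENNReal.mul_top hpos] at hle
    exact hne (top_le_iff.1 hle)
  refine (ENNReal.summable_toReal hfin).congr fun k => ?_
  rw [ENNReal.toReal_ofReal (mass_nonneg (killedLaw_coeff_nonneg h0.le h1 k))]

end Walk

/-! ### Monotonicity and location of the threshold -/

lemma returnPoly_pos {p : ℝ} (h0 : 0 ≤ p) (h1 : p ≤ 1) : 0 < returnPoly p := by
  have : 0 ≤ 1 - p := by linarith
  unfold returnPoly
  positivity

lemma returnPoly_mono {p q : ℝ} (h0 : 0 ≤ p) (hpq : p ≤ q) (h1 : q ≤ 1) :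
    returnPoly p ≤ returnPoly q := by
  have h : returnPoly q - returnPoly p = (q - p) * (1 / 2 * (1 - (p + q) / 2)
      + 3 / 64 * (8 * (p + q) - 4 * (p ^ 2 + p * q + q ^ 2)
        - (p + q) * (p ^ 2 + q ^ 2))) := by
    unfold returnPoly
    ring
  have hp1 : p ≤ 1 := hpq.trans h1
  have h3 : 0 ≤ 8 * (p + q) - 4 * (p ^ 2 + p * q + q ^ 2) - (p + q) * (p ^ 2 + q ^ 2) := by
    have a1 : p ^ 2 + q ^ 2 ≤ 2 := by nlinarith
    have a2 : (p + q) * (p ^ 2 + q ^ 2) ≤ (p + q) * 2 :=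
      mul_le_mul_of_nonneg_left a1 (by linarith)
    nlinarith [mul_nonneg h0 (sub_nonneg.2 hp1), mul_nonneg h0 (sub_nonneg.2 h1),
      mul_nonneg (h0.trans hpq) (sub_nonneg.2 h1), mul_nonneg (h0.trans hpq) (sub_nonneg.2 hp1)]
  have h4 : 0 ≤ 1 / 2 * (1 - (p + q) / 2) := by linarith
  have := mul_nonneg (sub_nonneg.2 hpq) (add_nonneg h4 (mul_nonneg (by norm_num : (0:ℝ) ≤ 3 / 64) h3))
  linarith

/-- The denominator of the equation for the threshold. -/
noncomputable def thresholdFun (p : ℝ) : ℝ := Real.pi * p * √(3 - 2 * p) * returnPoly p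

lemma continuous_thresholdFun : Continuous thresholdFun := by
  unfold thresholdFun returnPoly
  fun_prop

lemma thresholdFun_lt {p q : ℝ} (h0 : 0 < p) (hpq : p < q) (h1 : q ≤ 1) :
    thresholdFun p < thresholdFun q := by
  have hR := returnPoly_mono h0.le hpq.le h1
  have hRp := returnPoly_pos h0.le (hpq.le.trans h1)
  have hs : p * √(3 - 2 * p) < q * √(3 - 2 * q) := by
    -- Under the root the function is r²(3 - 2r), which increases on [0, 1].
    have e : ∀ r : ℝ, 0 ≤ r → r * √(3 - 2 * r) = √(r ^ 2 * (3 - 2 * r)) := fun r hr => by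
      rw [Real.sqrt_mul (sq_nonneg r), Real.sqrt_sq hr]
    rw [e p h0.le, e q (h0.trans hpq).le]
    refine Real.sqrt_lt_sqrt (mul_nonneg (sq_nonneg p) (by linarith)) ?_
    have : q ^ 2 * (3 - 2 * q) - p ^ 2 * (3 - 2 * p) =
        (q - p) * (2 * (p * (1 - p)) + 2 * (q * (1 - q)) + p * (1 - q) + q * (1 - p)) := by ring
    have : 0 < (q - p) * (2 * (p * (1 - p)) + 2 * (q * (1 - q)) + p * (1 - q) + q * (1 - p)) := by
      have : 0 < 1 - p := by linarith
      have : 0 ≤ 1 - q := by linarith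
      have : 0 < q - p := by linarith
      have : 0 < q := by linarith
      positivity
    linarith
  have hlt := mul_lt_mul hs hR hRp (mul_nonneg (h0.trans hpq).le (Real.sqrt_nonneg _))
  unfold thresholdFun
  have := mul_lt_mul_of_pos_left hlt Real.pi_pos
  linarith

lemma thresholdFun_lt_four : thresholdFun 0.7805 < 4 := by
  have hs : √(3 - 2 * 0.7805 : ℝ) ≤ 1.1995833 := by
    rw [Real.sqrt_le_left (by norm_num)]
    norm_num
  have hR : returnPoly 0.7805 ≤ 1.359853 := by
    unfold returnPoly
    norm_num
  have hR0 : 0 ≤ returnPoly 0.7805 := (returnPoly_pos (by norm_num) (by norm_num)).le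
  calc thresholdFun 0.7805 ≤ 3.141593 * 0.7805 * 1.1995833 * 1.359853 := by
        unfold thresholdFun
        gcongr
        exact Real.pi_lt_d6.le
    _ < 4 := by norm_num

lemma four_lt_thresholdFun : 4 < thresholdFun 0.7806 := by
  have hs : 1.1994998 ≤ √(3 - 2 * 0.7806 : ℝ) := by
    apply Real.le_sqrt_of_sq_le
    norm_num
  have hR : 1.359878 ≤ returnPoly 0.7806 := by
    unfold returnPoly
    norm_num
  calc (4 : ℝ) < 3.141592 * 0.7806 * 1.1994998 * 1.359878 := by norm_num
    _ ≤ thresholdFun 0.7806 := by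
        unfold thresholdFun
        gcongr
        exact Real.pi_gt_d6.le

/-- There is a threshold `p₀ = 0.7805…`, the solution of `4 / (π p √(3 - 2p) R₄(p)) = 1`, such that
for every error probability `p > p₀`, every sequence of instructions and every home other than the
origin, the guided random walk has infinite expected hitting time of home. -/
theorem mainTheorem1 :
    ∃ p₀ : ℝ, 0.7805 < p₀ ∧ p₀ < 0.7806 ∧
      4 / (Real.pi * p₀ * Real.sqrt (3 - 2 * p₀) * returnPoly p₀) = 1 ∧
      ∀ p : ℝ, p₀ < p → p ≤ 1 →
        ∀ x : ℕ → ℤ × ℤ, IsInstructionSequence x →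
        ∀ home : ℤ × ℤ, home ≠ 0 →
        ∀ {Ω : Type*} [MeasurableSpace Ω] (μ : Measure Ω) [IsProbabilityMeasure μ]
          (X : ℕ → Ω → ℤ × ℤ), IsGuidedRandomWalk μ p x X →
          ∫⁻ ω, hitTime X home ω ∂μ = ∞ := by
  -- The threshold is where `thresholdFun` takes the value 4; strict monotonicity then gives the
  -- strict inequality beyond it.
  obtain ⟨p₀, ⟨hlo, hhi⟩, hp₀⟩ := intermediate_value_Ioo (by norm_num : (0.7805 : ℝ) ≤ 0.7806)
    continuous_thresholdFun.continuousOn ⟨thresholdFun_lt_four, four_lt_thresholdFun⟩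
  refine ⟨p₀, hlo, hhi, ?_, ?_⟩
  · change 4 / thresholdFun p₀ = 1
    rw [hp₀]
    norm_num
  · intro p hp hp1 x hx home hhome Ω _ μ _ X hX
    have hp₀0 : 0 < p₀ := lt_trans (by norm_num) hlo
    have hp0 : 0 < p := hp₀0.trans hp
    have hlt := thresholdFun_lt hp₀0 hp hp1
    rw [hp₀, thresholdFun] at hlt
    refine hX.lintegral_hitTime_eq_top hx hp0 hp1 hhome ?_
    have hs : 0 < √(3 - 2 * p) := Real.sqrt_pos.2 (by linarith)
    have hpos : 0 < Real.pi * p * √(3 - 2 * p) := by positivity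
    rw [← mul_div_assoc, div_lt_iff₀ hpos]
    linarith
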